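/- Fix integers $n,N\ge 0$, numbers $\hbar^{1/2},q\in\mathbb{C}^\times$ (with $\hbar=(\hbar^{1/2})^2$), twist parameters $\zeta_1,\dots,\zeta_n\in\mathbb{C}$ and non-negative integers $s_1,\dots,s_n$. Let $V=(\mathbb{C}^n)^{\otimes N}$ with basis $E_J=e_{j_1}\otimes\cdots\otimes e_{j_N}$, $J=(j_1,\dots,j_N)\in\{1,\dots,n\}^N$, and let $V(\{s_c\})\subset V$ be the span of those $E_J$ in which each $c$ occurs exactly $s_c$ times. Let $e_{ab}$ be the matrix units and let $$R(u)=\sum_a e_{aa}\otimes e_{aa}+\frac{u-1}{\hbar^{1/2}u-\hbar^{-1/2}}\sum_{a\ne b}e_{aa}\otimes e_{bb}+\frac{\hbar^{1/2}-\hbar^{-1/2}}{\hbar^{1/2}u-\hbar^{-1/2}}\sum_{a<b}\bigl(u\,e_{ab}\otimes e_{ba}+e_{ba}\otimes e_{ab}\bigr)$$ be the trigonometric R-matrix; $R_{ij}(u)$ acts on the $i$-th and $j$-th tensor factors, and $Z^{(i)}$ is $\mathrm{diag}(\zeta_1,\dots,\zeta_n)$ acting on the $i$-th factor. For $a=(a_1,\dots,a_N)$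 put $$K_i^{(q)}=R_{i,i-1}\!\left(\tfrac{qa_i}{a_{i-1}}\right)\cdots R_{i,1}\!\left(\tfrac{qa_i}{a_1}\right)Z^{(i)}R_{i,N}\!\left(\tfrac{a_i}{a_N}\right)\cdots R_{i,i+1}\!\left(\tfrac{a_i}{a_{i+1}}\right),$$ and let $p_i$ be the shift operator $(p_if)(\dots,a_i,\dots)=f(\dots,qa_i,\dots)$. Let $D\subset(\mathbb{C}^\times)^N$ be a set closed under all shifts $a_i\mapsto qa_i$ and such that $a_i\ne a_j$ and $\hbar a_i\ne a_j$ for all $a\in D$ and $i\neq j$. Let $\Phi=\sum_J\Phi_JE_J:D\to V(\{s_c\})$ be any solution of the qKZ equations $p_i\Phi=K_i^{(q)}\Phi$, $i=1,\dots,N$. Put $$\Upsilon=\langle E^\hbar,\Phi\rangle=\sum_J\hbar^{\ell(J)/2}\Phi_J,\qquad E^\hbar=\sum_J\hbar^{\ell(J)/2}E_J,$$ where $\ell(J)$ is the number of inversions of $J$ (the minimal number of transpositions of neighbouring entries that put $J$ into weakly increasing order). **Theorem.** The function $\Upsilon$ is a joint eigenfunction of all rescaled trigonometric Ruijsenaars–Schneider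 Hamiltonians $$\widehat H_d=\hbar^{-d(N-d)/2}\,T_d\big|_{t=\hbar},\qquad T_d=\sum_{\substack{I\subset\{1,\dots,N\}\\|I|=d}}\ \prod_{i\in I,\,j\notin I}\frac{t\,a_i-a_j}{a_i-a_j}\ \prod_{i\in I}p_i .$$ Precisely, on $D$ and for every $d\ge 0$, $$\widehat H_d\,\Upsilon=e_d\Bigl(\bigl\{\zeta_c\,\hbar^{\frac{s_c-1}{2}-k}\;:\;1\le c\le n,\ 0\le k\le s_c-1\bigr\}\Bigr)\,\Upsilon ,$$ (an identity of functions; $\Upsilon$ is not claimed to be non-zero), where $e_d$ is the $d$-th elementary symmetric polynomial of the listed numbers (a multiset); in particular the eigenvalue depends only on $\hbar$, the $\zeta_c$ and the $s_c$. -/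

import Mathlib

open scoped Matrix Kronecker

namespace QKZ

/-! Throughout, `η` is the fixed square root `ħ^(1/2)`, so that `ħ = η ^ 2`. There are `N` sites,
each carrying `ℂ^n`. The space `V = (ℂ^n)^{⊗ N}` is written in the basis
`E_J = e_{j_1} ⊗ ... ⊗ e_{j_N}` indexed by multi-indices `J : Fin N → Fin n`, so a vector of `V` is
its family of coefficients and an operator on `V` is its matrix. -/

/-- The space `V = (ℂ^n)^{⊗ N}`, in coordinates with respect to the basis `E_J`. -/
abbrev Space (n N : ℕ) : Type := (Fin N → Fin n) → ℂ

/-- Operators on `V`, in the basis `E_J`. -/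
abbrev Op (n N : ℕ) : Type := Matrix (Fin N → Fin n) (Fin N → Fin n) ℂ

/-- The matrix unit `e_{ab}`. -/
noncomputable def e {n : ℕ} (a b : Fin n) : Matrix (Fin n) (Fin n) ℂ := Matrix.single a b 1

/-- The trigonometric R-matrix on `ℂ^n ⊗ ℂ^n`, with multiplicative spectral parameter `u`. With
`u = x ^ 2`, the two scalar factors are `(x - x⁻¹) / (η x - η⁻¹ x⁻¹)` and
`(η - η⁻¹) / (η x - η⁻¹ x⁻¹)` times `x` (for `a < b`) or `x⁻¹` (for `a > b`). -/
noncomputable def rMatrix (n : ℕ) (η u : ℂ) : Matrix (Fin n × Fin n) (Fin n × Fin n) ℂ :=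
  (∑ a : Fin n, e a a ⊗ₖ e a a)
    + ((u - 1) / (η * u - η⁻¹)) • (∑ a : Fin n, ∑ b : Fin n with a ≠ b, e a a ⊗ₖ e b b)
    + ((η - η⁻¹) / (η * u - η⁻¹)) •
        (∑ a : Fin n, ∑ b : Fin n with a < b, (u • (e a b ⊗ₖ e b a) + e b a ⊗ₖ e a b))

/-- `M_{ij}`: the operator on `V` acting by `M` on the `i`-th (first factor of `M`) and the `j`-th
(second factor of `M`) sites, and by the identity on all other sites; used for `i ≠ j`. -/
def onSites {n N : ℕ} (i j : Fin N) (M : Matrix (Fin n × Fin n) (Fin n × Fin n) ℂ) : Op n N :=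
  Matrix.of fun J K =>
    if ∀ k, k ≠ i → k ≠ j → J k = K k then M (J i, J j) (K i, K j) else 0

/-- `R_{ij}(u)`. -/
noncomputable def R {n N : ℕ} (η : ℂ) (i j : Fin N) (u : ℂ) : Op n N :=
  onSites i j (rMatrix n η u)

/-- `Z^{(i)}`: the twist `diag(ζ_1, ..., ζ_n)` acting on the `i`-th site. -/
def Z {n N : ℕ} (ζ : Fin n → ℂ) (i : Fin N) : Op n N :=
  Matrix.diagonal fun J => ζ (J i)

/-- The qKZ operator
`K_i^{(q)} = R_{i,i-1}(q a_i / a_{i-1}) ⋯ R_{i,1}(q a_i / a_1) Z^{(i)}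
  R_{i,N}(a_i / a_N) ⋯ R_{i,i+1}(a_i / a_{i+1})`. -/
noncomputable def K {n N : ℕ} (η q : ℂ) (ζ : Fin n → ℂ) (a : Fin N → ℂ) (i : Fin N) : Op n N :=
  ((((List.finRange N).filter (fun j => j < i)).reverse.map
      (fun j => R η i j (q * a i / a j))).prod)
    * Z ζ i
    * ((((List.finRange N).filter (fun j => i < j)).reverse.map
      (fun j => R η i j (a i / a j))).prod)

/-- The point obtained from `a` by multiplying the coordinates `a_i`, `i ∈ I`, by `q`: for a
function `f`, `((∏_{i ∈ I} p_i) f) a = f (qShift q I a)`, where `p_i` is the shift operator. -/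
def qShift {N : ℕ} (q : ℂ) (I : Finset (Fin N)) (a : Fin N → ℂ) : Fin N → ℂ :=
  fun j => if j ∈ I then q * a j else a j

/-- The locus on which no coefficient of the qKZ operators and of the tRS operators has a
vanishing denominator. -/
def regularLocus (N : ℕ) (η : ℂ) : Set (Fin N → ℂ) :=
  {a | (∀ i, a i ≠ 0) ∧ ∀ i j, i ≠ j → a i ≠ a j ∧ η ^ 2 * a i ≠ a j}

/-- The weight subspace `V({s_a})`: the span of the `E_J` in which each `c` occurs `s c` times, i.e.
the joint eigenspace of the operators `S_c = ∑_k e_{cc}^{(k)}` with eigenvalues `s c`. -/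
def weightSpace {n : ℕ} (N : ℕ) (s : Fin n → ℕ) : Submodule ℂ (Space n N) where
  carrier := {v | ∀ J, v J ≠ 0 → ∀ c, (Finset.univ.filter fun k => J k = c).card = s c}
  zero_mem' := by
    intro J hJ
    exact absurd rfl hJ
  add_mem' := by
    intro v w hv hw J hJ
    by_cases h : v J = 0
    · refine hw J fun h' => hJ ?_
      simp [h, h']
    · exact hv J h
  smul_mem' := by
    intro r v hv J hJ
    refine hv J fun h => hJ ?_
    simp [h]

/-- `ℓ(J)`: the number of inversions of `J`, i.e. the least number of transpositions of neighbouring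
entries that put `J` into weakly increasing order. -/
def len {n N : ℕ} (J : Fin N → Fin n) : ℕ :=
  (Finset.univ.filter fun p : Fin N × Fin N => p.1 < p.2 ∧ J p.2 < J p.1).card

/-- The vector `E^ħ = ∑_J ħ^{ℓ(J)/2} E_J`. -/
def Evec (n N : ℕ) (η : ℂ) : Space n N := fun J => η ^ len J

/-- `Υ = ⟨E^ħ, Φ⟩ = ∑_J ħ^{ℓ(J)/2} Φ_J`, for a `V`-valued function `Φ`. -/
def Upsilon {n N : ℕ} (η : ℂ) (Φ : (Fin N → ℂ) → Space n N) : (Fin N → ℂ) → ℂ :=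
  fun a => Evec n N η ⬝ᵥ Φ a

/-- The trigonometric Ruijsenaars-Schneider Hamiltonian
`T_d = ∑_{|I| = d} ∏_{i ∈ I, j ∉ I} (t a_i - a_j) / (a_i - a_j) ∏_{i ∈ I} p_i`. -/
noncomputable def tRS {N : ℕ} (q t : ℂ) (d : ℕ) (f : (Fin N → ℂ) → ℂ) : (Fin N → ℂ) → ℂ :=
  fun a => ∑ I ∈ (Finset.univ : Finset (Fin N)).powersetCard d,
    (∏ i ∈ I, ∏ j ∈ Iᶜ, (t * a i - a j) / (a i - a j)) * f (qShift q I a)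

/-- The rescaled Hamiltonian `Ĥ_d = ħ^{-d(N-d)/2} T_d` at `t = ħ`, i.e. the operator
`∑_{|I| = d} ∏_{i ∈ I, j ∉ I} (ħ^{1/2} a_i - ħ^{-1/2} a_j) / (a_i - a_j) ∏_{i ∈ I} p_i`. -/
noncomputable def tRSHat {N : ℕ} (η q : ℂ) (d : ℕ) (f : (Fin N → ℂ) → ℂ) : (Fin N → ℂ) → ℂ :=
  fun a => η ^ (-((d : ℤ) * ((N : ℤ) - (d : ℤ)))) * tRS q (η ^ 2) d f a

/-- The multiset of the numbers `ζ_c ħ^{(s_c - 1)/2 - k}`, `1 ≤ c ≤ n`, `0 ≤ k ≤ s_c - 1`. -/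
noncomputable def strings {n : ℕ} (η : ℂ) (ζ : Fin n → ℂ) (s : Fin n → ℕ) : Multiset ℂ :=
  ∑ c : Fin n,
    (Multiset.range (s c)).map fun k => ζ c * η ^ ((s c : ℤ) - 1 - 2 * (k : ℤ))

end QKZ

/-!
The qKZ equations express every shifted value `Φ(q^I a)` through `Φ(a)`, so `Ĥ_d Υ` is the pairing
of `Φ(a)` with a covector, and the theorem says that this covector is a multiple of `E^ħ` on each
weight subspace.

*The shift parameter drops out.* The covector `E^ħ` satisfies `E^ħ R_{i,i-1}(u) = E^ħ P_{i,i-1}`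
for every `u` that is not a pole. If the equations for the sites of `I` are used from the smallest site to the
largest, the R-matrices that contain `q` always meet the covector in this way and only permute the
order in which the inversions of `J` are counted. What remains (`upsilon_qShift`) is the covector
`shiftCov I = ⟨E^ħ| ∏_{i ∈ I} K_i` at `q = 1`. It is defined for an arbitrary list of sites, the
list giving the order of the sites, while the labelling of parameters and letters by sites stays
fixed.

*Exchange relation.* By the Yang-Baxter equation and unitarity, multiplying `shiftCov` by the
R-matrix of two neighbouring sites interchanges these sites in the list (`shiftCov_vecMul_normR`).
The coefficients of the Hamiltonians do not depend on the order, so `hamCov d`, the sum of the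
`shiftCov I` with these coefficients, satisfies the same relation, and so does `E^ħ`. In the
relation the coefficient `a_k - a_l` is non-zero, therefore an identity between two such covectors
at a sequence of letters implies the identity at all rearrangements (`EigenAt.swap`), and it
suffices to treat weakly decreasing letters.

*Weakly decreasing letters.* Let `x` be the last site, whose letter `c` is then minimal. If `x ∈
I`, the site `x` crosses no other site and `shiftCov` reduces to the covector of the remaining
sites with modified twists (`shiftCov_insert_last`). If `x ∉ I`, then `shiftCov I` is, up to an
explicit denominator, a polynomial in `a_x`, whose top coefficient again involves only the
remaining sites, because the R-matrix at `u = 0` is diagonal on the relevant vectors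
(`vecMul_lineCross_top_eq`). Multiplied by `∏_j (a_x - a_j)`, the component of `hamCov d` is a
polynomial in `a_x` of degree at most the number of remaining sites `j`, and it vanishes at each
`a_x = a_j`, since there `x` and `j` may be interchanged in `I` (`shiftCov_insert_eq`). So the
component equals the top coefficient, which gives a recursion on the number of sites
(`hamCov_append_singleton`). The elementary symmetric functions of the `η`-strings satisfy the
same recursion (`strings_update`).
-/

namespace QKZ

variable {n N : ℕ}

/-! ### The R-matrix with cleared denominator -/

/-- `(η x - η⁻¹ y) R_{ij}(x / y)`, a matrix whose entries are linear in `x` and `y`. -/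
noncomputable def clearedR (η x y : ℂ) (i j : Fin N) : Op n N :=
  Matrix.of fun K J =>
    if K = J then (if J i = J j then η * x - η⁻¹ * y else x - y)
    else if K = J ∘ Equiv.swap i j then (η - η⁻¹) * (if J j < J i then x else y) else 0

/-- `R_{ij}(x / y)`, as a function of the two numbers `x` and `y`. -/
noncomputable def normR (η x y : ℂ) (i j : Fin N) : Op n N :=
  (η * x - η⁻¹ * y)⁻¹ • clearedR η x y i j

theorem rMatrix_apply (η u : ℂ) (a b c d : Fin n) :
    rMatrix n η u (a, b) (c, d) =
      if a = c ∧ b = d then (if a = b then 1 else (u - 1) / (η * u - η⁻¹))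
      else if a = d ∧ b = c then
        (η - η⁻¹) / (η * u - η⁻¹) * (if a < b then u else 1) else 0 := by
  have h1 : (∑ x : Fin n, e x x ⊗ₖ e x x) (a, b) (c, d)
      = if a = c ∧ b = d ∧ a = b then 1 else 0 := by
    simp only [Matrix.sum_apply, Matrix.kronecker_apply, e, Matrix.single_apply]
    rw [Finset.sum_eq_single a]
    · grind
    · intro x _ hx; simp [hx]
    · simp
  have h2 : (∑ x : Fin n, ∑ y : Fin n with x ≠ y, e x x ⊗ₖ e y y) (a, b) (c, d)
      = if a = c ∧ b = d ∧ a ≠ b then 1 else 0 := by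
    simp only [Matrix.sum_apply, Matrix.kronecker_apply, e, Matrix.single_apply]
    simp only [Finset.sum_filter]
    rw [Finset.sum_eq_single a]
    · rw [Finset.sum_eq_single b]
      · grind
      · intro x _ hx; simp [hx]
      · simp
    · intro x _ hx; simp [hx]
    · simp
  have h3 : (∑ x : Fin n, ∑ y : Fin n with x < y, (u • (e x y ⊗ₖ e y x) + e y x ⊗ₖ e x y))
      (a, b) (c, d)
      = if a = d ∧ b = c ∧ a ≠ b then (if a < b then u else 1) else 0 := by
    simp only [Matrix.sum_apply, Matrix.add_apply, Matrix.smul_apply, Matrix.kronecker_apply, e,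
      Matrix.single_apply, smul_eq_mul]
    simp only [Finset.sum_filter]
    rcases lt_trichotomy a b with hab | hab | hab
    · rw [Finset.sum_eq_single a, Finset.sum_eq_single b]
      · grind
      · intro x _ hx; grind
      · simp
      · intro x _ hx
        refine Finset.sum_eq_zero fun y _ => ?_
        grind
      · simp
    · rw [if_neg (by simp [hab])]
      refine Finset.sum_eq_zero fun x _ => Finset.sum_eq_zero fun y _ => ?_
      grind
    · rw [Finset.sum_eq_single b, Finset.sum_eq_single a]
      · grind
      · intro x _ hx; simp [hx]; grind
      · simp
      · intro x _ hx
        refine Finset.sum_eq_zero fun y _ => ?_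
        grind
      · simp
  rw [rMatrix, Matrix.add_apply, Matrix.add_apply, Matrix.smul_apply, Matrix.smul_apply, h1, h2, h3]
  simp only [smul_eq_mul]
  grind

/-- Where the denominator vanishes the two sides differ: only the left-hand side then has diagonal
entries `1` at pairs of equal letters. -/
theorem R_eq_normR (η x y : ℂ) (i j : Fin N) (hy : y ≠ 0)
    (h : η * x - η⁻¹ * y ≠ 0) : (R η i j (x / y) : Op n N) = normR η x y i j := by
  have hu : η * (x / y) - η⁻¹ = (η * x - η⁻¹ * y) / y := by field_simp
  ext K J
  rw [R, onSites, normR, clearedR, Matrix.smul_apply, Matrix.of_apply, Matrix.of_apply,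
    rMatrix_apply, hu, smul_eq_mul]
  by_cases hKJ : K = J
  · subst hKJ
    simp only [implies_true, if_true, and_self]
    by_cases hK : K i = K j
    · simp [hK, h]
    · simp only [hK, if_false]
      field_simp
  · rw [if_neg hKJ]
    by_cases hs : K = J ∘ Equiv.swap i j
    · have hi : K i = J j := by simp [hs]
      have hj : K j = J i := by simp [hs]
      have hne : J i ≠ J j := by
        intro hJ
        apply hKJ
        rw [hs]
        funext k
        by_cases hki : k = i
        · simp [hki, hJ]
        · by_cases hkj : k = j
          · simp [hkj, hJ]
          · simp [Equiv.swap_apply_of_ne_of_ne hki hkj]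
      have hall : ∀ k, k ≠ i → k ≠ j → K k = J k := fun k hki hkj => by
        simp [hs, Equiv.swap_apply_of_ne_of_ne hki hkj]
      rw [if_pos hall, if_pos hs, hi, hj, if_neg (by simp [hne.symm]), if_pos (by simp)]
      split_ifs <;> field_simp
    · rw [if_neg hs, mul_zero]
      split_ifs with h1 h2 h3 h4
      all_goals try rfl
      all_goals exfalso
      · apply hKJ; funext k; grind
      · apply hKJ; funext k; grind
      all_goals
        apply hs; funext k
        by_cases hki : k = i
        · simp [hki]; grind
        · by_cases hkj : k = j
          · simp [hkj]; grind
          · simp [Equiv.swap_apply_of_ne_of_ne hki hkj]; grind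

theorem comp_swap_of_eq {J : Fin N → Fin n} {i j : Fin N} (h : J i = J j) :
    J ∘ Equiv.swap i j = J := by
  funext k
  by_cases hki : k = i
  · simp [hki, h]
  · by_cases hkj : k = j
    · simp [hkj, h]
    · simp [Equiv.swap_apply_of_ne_of_ne hki hkj]

theorem vecMul_clearedR (η x y : ℂ) (i j : Fin N) (C : Space n N) (J : Fin N → Fin n) :
    (C ᵥ* clearedR η x y i j) J =
      if J i = J j then (η * x - η⁻¹ * y) * C J
      else (x - y) * C J
        + (η - η⁻¹) * (if J j < J i then x else y) * C (J ∘ Equiv.swap i j) := by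
  by_cases h : J i = J j
  · rw [if_pos h, Matrix.vecMul, dotProduct, Finset.sum_eq_single J]
    · simp [clearedR, h, mul_comm]
    · intro K _ hK
      simp [clearedR, hK, comp_swap_of_eq h]
    · simp
  · have hne : J ∘ Equiv.swap i j ≠ J := fun h' => h (by
      have := congrFun h' j
      simpa using this)
    rw [if_neg h, Matrix.vecMul, dotProduct, Finset.sum_eq_add J (J ∘ Equiv.swap i j) hne.symm]
    · simp only [clearedR, Matrix.of_apply, h, hne, if_true, if_false]
      ring
    · intro K _ hK
      simp [clearedR, hK.1, hK.2]
    · simp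
    · simp

theorem vecMul_normR (η x y : ℂ) (i j : Fin N) (C : Space n N) (J : Fin N → Fin n) :
    (C ᵥ* normR η x y i j) J = (η * x - η⁻¹ * y)⁻¹ *
      if J i = J j then (η * x - η⁻¹ * y) * C J
      else (x - y) * C J
        + (η - η⁻¹) * (if J j < J i then x else y) * C (J ∘ Equiv.swap i j) := by
  rw [normR, Matrix.vecMul_smul, Pi.smul_apply, vecMul_clearedR, smul_eq_mul]

theorem op_ext {A B : Op n N} (h : ∀ (C : Space n N) J, (C ᵥ* A) J = (C ᵥ* B) J) : A = B := by
  ext K J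
  simpa using h (Pi.single K 1) J

/-! ### Yang-Baxter equation, unitarity, commutation -/

/-- The multi-index `J` with the letters at `i`, `j`, `k` replaced. -/
def place (J : Fin N → Fin n) (i j k : Fin N) (b c d : Fin n) : Fin N → Fin n :=
  Function.update (Function.update (Function.update J i b) j c) k d

theorem clearedR_yangBaxter (η x y z : ℂ) (hη : η ≠ 0) {i j k : Fin N} (hij : i ≠ j) (hik : i ≠ k)
    (hjk : j ≠ k) :
    (clearedR η x y i j * clearedR η x z i k * clearedR η y z j k : Op n N)
      = clearedR η y z j k * clearedR η x z i k * clearedR η x y i j := by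
  refine op_ext fun C J => ?_
  have hJ : J = place J i j k (J i) (J j) (J k) := by
    simp [place]
  have hi : ∀ b c d, place J i j k b c d i = b := fun b c d => by simp [place, hij, hik]
  have hj : ∀ b c d, place J i j k b c d j = c := fun b c d => by simp [place, hjk]
  have hk : ∀ b c d, place J i j k b c d k = d := fun b c d => by simp [place]
  have s1 : ∀ b c d, place J i j k b c d ∘ Equiv.swap i j = place J i j k c b d := by
    intro b c d; funext m; simp only [place, Function.comp_apply, Function.update_apply,
      Equiv.swap_apply_def]; grind
  have s2 : ∀ b c d, place J i j k b c d ∘ Equiv.swap i k = place J i j k d c b := by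
    intro b c d; funext m; simp only [place, Function.comp_apply, Function.update_apply,
      Equiv.swap_apply_def]; grind
  have s3 : ∀ b c d, place J i j k b c d ∘ Equiv.swap j k = place J i j k b d c := by
    intro b c d; funext m; simp only [place, Function.comp_apply, Function.update_apply,
      Equiv.swap_apply_def]; grind
  have hη' : η * η⁻¹ = 1 := mul_inv_cancel₀ hη
  -- only the letters at the three sites matter, and only their relative order
  rw [hJ]
  simp only [← Matrix.vecMul_vecMul, vecMul_clearedR, hi, hj, hk, s1, s2, s3]
  clear hJ hi hj hk s1 s2 s3
  generalize J i = b
  generalize J j = c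
  generalize J k = d
  have tri : ∀ b c : Fin n, (b < c ∧ ¬ c < b ∧ b ≠ c ∧ c ≠ b) ∨ b = c ∨
      (c < b ∧ ¬ b < c ∧ b ≠ c ∧ c ≠ b) := fun b c => by
    rcases lt_trichotomy b c with h | h | h
    · exact Or.inl ⟨h, h.not_gt, h.ne, h.ne'⟩
    · exact Or.inr (Or.inl h)
    · exact Or.inr (Or.inr ⟨h, h.not_gt, h.ne', h.ne⟩)
  rcases tri b c with ⟨_, _, _, _⟩ | h1 | ⟨_, _, _, _⟩ <;>
    rcases tri c d with ⟨_, _, _, _⟩ | h2 | ⟨_, _, _, _⟩ <;>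
    rcases tri b d with ⟨_, _, _, _⟩ | h3 | ⟨_, _, _, _⟩ <;>
    first
    | (exfalso; order)
    | (subst_vars
       simp only [*, if_true, if_false, lt_irrefl]
       try field_simp
       try ring)

theorem clearedR_mul_swap (η x y : ℂ) (hη : η ≠ 0) (i j : Fin N) :
    (clearedR η x y i j * clearedR η y x j i : Op n N)
      = ((η * x - η⁻¹ * y) * (η * y - η⁻¹ * x)) • 1 := by
  refine op_ext fun C J => ?_
  have hs : ∀ J : Fin N → Fin n, (J ∘ Equiv.swap j i) ∘ Equiv.swap i j = J := fun J => by
    funext k; simp [Equiv.swap_comm j i]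
  simp only [← Matrix.vecMul_vecMul, vecMul_clearedR, hs, Matrix.vecMul_smul, Matrix.vecMul_one,
    Pi.smul_apply, smul_eq_mul, Function.comp_apply, Equiv.swap_apply_left,
    Equiv.swap_apply_right]
  simp only [Equiv.swap_comm j i]
  rcases lt_trichotomy (J i) (J j) with h | h | h
  · simp only [h, h.ne, h.ne', h.not_gt, if_true, if_false]
    field_simp
    ring
  · simp only [h, if_true]
    ring
  · simp only [h, h.ne, h.ne', h.not_gt, if_true, if_false]
    field_simp
    ring

theorem clearedR_commute (η x y x' y' : ℂ) {i j k l : Fin N} (hik : i ≠ k) (hil : i ≠ l)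
    (hjk : j ≠ k) (hjl : j ≠ l) :
    Commute (clearedR η x y i j : Op n N) (clearedR η x' y' k l) := by
  refine op_ext fun C J => ?_
  have hs : (J ∘ Equiv.swap i j) ∘ Equiv.swap k l = (J ∘ Equiv.swap k l) ∘ Equiv.swap i j := by
    funext m
    simp only [Function.comp_apply, Equiv.swap_apply_def]
    grind
  have h1 : Equiv.swap i j k = k := Equiv.swap_apply_of_ne_of_ne hik.symm hjk.symm
  have h2 : Equiv.swap i j l = l := Equiv.swap_apply_of_ne_of_ne hil.symm hjl.symm
  have h3 : Equiv.swap k l i = i := Equiv.swap_apply_of_ne_of_ne hik hil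
  have h4 : Equiv.swap k l j = j := Equiv.swap_apply_of_ne_of_ne hjk hjl
  simp only [← Matrix.vecMul_vecMul, vecMul_clearedR, hs, Function.comp_apply, h1, h2, h3, h4]
  split_ifs <;> ring

theorem normR_yangBaxter (η x y z : ℂ) (hη : η ≠ 0) {i j k : Fin N} (hij : i ≠ j) (hik : i ≠ k)
    (hjk : j ≠ k) :
    (normR η x y i j * normR η x z i k * normR η y z j k : Op n N)
      = normR η y z j k * normR η x z i k * normR η x y i j := by
  simp only [normR, smul_mul_assoc, mul_smul_comm, smul_smul,
    clearedR_yangBaxter η x y z hη hij hik hjk]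
  congr 1
  ring

theorem normR_mul_swap {η x y : ℂ} (hη : η ≠ 0) (hxy : η * x - η⁻¹ * y ≠ 0)
    (hyx : η * y - η⁻¹ * x ≠ 0) (i j : Fin N) :
    (normR η x y i j * normR η y x j i : Op n N) = 1 := by
  simp only [normR, smul_mul_assoc, mul_smul_comm, smul_smul, clearedR_mul_swap η x y hη]
  rw [show ∀ u v : ℂ, v⁻¹ * (u⁻¹ * (u * v)) = (u⁻¹ * u) * (v⁻¹ * v) from fun u v => by ring,
    inv_mul_cancel₀ hxy, inv_mul_cancel₀ hyx, one_mul, one_smul]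

theorem normR_commute (η x y x' y' : ℂ) {i j k l : Fin N} (hik : i ≠ k) (hil : i ≠ l)
    (hjk : j ≠ k) (hjl : j ≠ l) :
    Commute (normR η x y i j : Op n N) (normR η x' y' k l) :=
  ((clearedR_commute η x y x' y' hik hil hjk hjl).smul_left _).smul_right _

/-- At coinciding parameters the R-matrix is the permutation of the two sites. -/
theorem vecMul_normR_self {η x : ℂ} (h : η * x - η⁻¹ * x ≠ 0) (i j : Fin N) (C : Space n N)
    (J : Fin N → Fin n) : (C ᵥ* normR η x x i j) J = C (J ∘ Equiv.swap i j) := by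
  rw [vecMul_normR]
  split_ifs with h1 h2
  · rw [comp_swap_of_eq h1, inv_mul_cancel_left₀ h]
  all_goals
    rw [sub_self, zero_mul, zero_add, sub_mul, inv_mul_cancel_left₀ h]

/-! ### Covectors attached to an ordering of the sites -/

/-- The factor of `ħ^{ℓ(J)/2}` contributed by the site `i` standing before the site `k`. -/
noncomputable def invFactor (η : ℂ) (J : Fin N → Fin n) (i k : Fin N) : ℂ :=
  if J k < J i then η else 1

/-- The covector `E^ħ` for the sites of the list `v`, in the order in which the list has them: its
value at `J` is `η` to the number of inversions of `J` along `v`. -/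
noncomputable def orderCov (η : ℂ) : List (Fin N) → Space n N
  | [] => fun _ => 1
  | i :: v => fun J => (v.map (invFactor η J i)).prod * orderCov η v J

/-- The covector `orderCov η v`, twisted at the sites of `I`. -/
noncomputable def startCov (η : ℂ) (ζ : Fin n → ℂ) (v : List (Fin N)) (I : Finset (Fin N)) :
    Space n N :=
  fun J => orderCov η v J * ∏ i ∈ I, ζ (J i)

theorem orderCov_append (η : ℂ) (p t : List (Fin N)) (J : Fin N → Fin n) :
    orderCov η (p ++ t) J = orderCov η p J
      * (p.map fun i => (t.map (invFactor η J i)).prod).prod * orderCov η t J := by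
  induction p with
  | nil => simp [orderCov]
  | cons i p ih => simp [orderCov, ih]; ring

theorem orderCov_comp (η : ℂ) (v : List (Fin N)) (σ : Fin N → Fin N) (J : Fin N → Fin n) :
    orderCov η v (J ∘ σ) = orderCov η (v.map σ) J := by
  induction v with
  | nil => rfl
  | cons i v ih =>
    simp only [orderCov, ih, List.map_cons, List.map_map]
    rfl

theorem map_swap_eq_self {i j : Fin N} {p : List (Fin N)} (hi : i ∉ p) (hj : j ∉ p) :
    p.map (Equiv.swap i j) = p := by
  conv_rhs => rw [← List.map_id p]
  refine List.map_congr_left fun k hk => ?_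
  exact Equiv.swap_apply_of_ne_of_ne (fun h => hi (h ▸ hk)) (fun h => hj (h ▸ hk))

theorem startCov_comp_swap (η : ℂ) (ζ : Fin n → ℂ) (v : List (Fin N)) (I : Finset (Fin N))
    (i j : Fin N) (J : Fin N → Fin n) :
    startCov η ζ v I (J ∘ Equiv.swap i j)
      = startCov η ζ (v.map (Equiv.swap i j)) (I.map (Equiv.swap i j).toEmbedding) J := by
  simp [startCov, orderCov_comp]

theorem map_swap_of_mem_iff {i j : Fin N} {I : Finset (Fin N)} (h : i ∈ I ↔ j ∈ I) :
    I.map (Equiv.swap i j).toEmbedding = I := by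
  ext k
  simp only [Finset.mem_map_equiv, Equiv.symm_swap, Equiv.swap_apply_def]
  split_ifs with h1 h2
  · rw [h1, h]
  · rw [h2, h]
  · rfl

/-- Two sites with the same twist that are neighbours in the ordering are interchanged by the
R-matrix, whatever its parameter, poles excepted. -/
theorem startCov_vecMul_normR {η x y : ℂ} (hη : η ≠ 0) (hxy : η * x - η⁻¹ * y ≠ 0) (ζ : Fin n → ℂ)
    {i j : Fin N} {p r : List (Fin N)} (hip : i ∉ p) (hjp : j ∉ p) (hir : i ∉ r) (hjr : j ∉ r)
    {I : Finset (Fin N)} (hI : i ∈ I ↔ j ∈ I) :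
    startCov η ζ (p ++ j :: i :: r) I ᵥ* normR η x y i j = startCov η ζ (p ++ i :: j :: r) I := by
  funext J
  have hs : startCov η ζ (p ++ j :: i :: r) I (J ∘ Equiv.swap i j)
      = startCov η ζ (p ++ i :: j :: r) I J := by
    rw [startCov_comp_swap, map_swap_of_mem_iff hI]
    simp [map_swap_eq_self hip hjp, map_swap_eq_self hir hjr]
  have hrel : startCov η ζ (p ++ j :: i :: r) I J * invFactor η J i j
      = startCov η ζ (p ++ i :: j :: r) I J * invFactor η J j i := by
    simp only [startCov, orderCov_append, orderCov, List.map_cons, List.prod_cons]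
    rw [List.map_congr_left (l := p) (g := fun k => invFactor η J k i * (invFactor η J k j *
      (r.map (invFactor η J k)).prod)) fun k _ => by ring]
    ring
  rw [vecMul_normR, hs]
  rw [inv_mul_eq_iff_eq_mul₀ hxy]
  unfold invFactor at hrel
  rcases lt_trichotomy (J i) (J j) with h | h | h
  · simp only [h, h.ne, h.not_gt, if_true, if_false, mul_one] at hrel ⊢
    rw [hrel]
    field_simp
    ring
  · simp only [h, lt_irrefl, if_false, if_true, mul_one] at hrel ⊢
    rw [hrel]
  · simp only [h, h.ne', h.not_gt, if_true, if_false, mul_one] at hrel ⊢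
    rw [← hrel]
    field_simp
    ring

/-! ### Products of R-matrices and the exchange relation -/

/-- The product `R_{i,r_m}(a_i / a_{r_m}) ⋯ R_{i,r_1}(a_i / a_{r_1})` over the list
`r = [r_1, ..., r_m]`. -/
noncomputable def passR (η : ℂ) (a : Fin N → ℂ) (i : Fin N) (r : List (Fin N)) : Op n N :=
  (r.reverse.map fun j => normR η (a i) (a j) i j).prod

/-- The product over the sites `i ∈ I` of the list, the last one standing leftmost, of the operators
that pass `i` through all sites that follow it in the list. -/
noncomputable def crossR (η : ℂ) (a : Fin N → ℂ) (I : Finset (Fin N)) : List (Fin N) → Op n N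
  | [] => 1
  | i :: w => if i ∈ I then crossR η a I w * passR η a i w else crossR η a I w

/-- The list `w` with the sites of `I` moved to the front in reversed order. -/
def frontList (I : Finset (Fin N)) (w : List (Fin N)) : List (Fin N) :=
  (w.filter (· ∈ I)).reverse ++ w.filter (· ∉ I)

/-- The covector `⟨E^ħ| ∏_{i ∈ I} K_i` at `q = 1`, for the sites of the list `w` in the order of
the list. -/
noncomputable def shiftCov (η : ℂ) (ζ : Fin n → ℂ) (a : Fin N → ℂ) (I : Finset (Fin N))
    (w : List (Fin N)) : Space n N :=
  startCov η ζ (frontList I w) I ᵥ* crossR η a I w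

@[simp] theorem passR_nil (η : ℂ) (a : Fin N → ℂ) (i : Fin N) :
    (passR η a i [] : Op n N) = 1 := rfl

theorem passR_append (η : ℂ) (a : Fin N → ℂ) (i : Fin N) (p t : List (Fin N)) :
    (passR η a i (p ++ t) : Op n N) = passR η a i t * passR η a i p := by
  simp [passR]

theorem passR_cons (η : ℂ) (a : Fin N → ℂ) (i j : Fin N) (r : List (Fin N)) :
    (passR η a i (j :: r) : Op n N) = passR η a i r * normR η (a i) (a j) i j := by
  simp [passR]

theorem passR_commute (η : ℂ) (a : Fin N → ℂ) (x y : ℂ) {i k l : Fin N} {r : List (Fin N)}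
    (hk : i ≠ k) (hl : i ≠ l) (hkr : k ∉ r) (hlr : l ∉ r) :
    Commute (passR η a i r : Op n N) (normR η x y k l) := by
  induction r with
  | nil => exact Commute.one_left _
  | cons j r ih =>
    simp only [List.mem_cons, not_or] at hkr hlr
    rw [passR_cons]
    exact (ih hkr.2 hlr.2).mul_left (normR_commute _ _ _ _ _ hk hl (Ne.symm hkr.1) (Ne.symm hlr.1))

theorem crossR_commute (η : ℂ) (a : Fin N → ℂ) (I : Finset (Fin N)) (x y : ℂ) {k l : Fin N}
    {w : List (Fin N)} (hk : k ∉ w) (hl : l ∉ w) :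
    Commute (crossR η a I w : Op n N) (normR η x y k l) := by
  induction w with
  | nil => exact Commute.one_left _
  | cons i w ih =>
    simp only [List.mem_cons, not_or] at hk hl
    rw [crossR]
    split_ifs
    · exact (ih hk.2 hl.2).mul_left (passR_commute _ _ _ _ (Ne.symm hk.1) (Ne.symm hl.1) hk.2 hl.2)
    · exact ih hk.2 hl.2

theorem passR_mul_normR (η : ℂ) (hη : η ≠ 0) (a : Fin N → ℂ) {i k l : Fin N} {p r : List (Fin N)}
    (h : (i :: (p ++ l :: k :: r)).Nodup) :
    (passR η a i (p ++ l :: k :: r) * normR η (a k) (a l) k l : Op n N)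
      = normR η (a k) (a l) k l * passR η a i (p ++ k :: l :: r) := by
  simp only [List.nodup_cons, List.nodup_append, List.mem_append, List.mem_cons, not_or] at h
  obtain ⟨⟨hip, hil, hik, hir⟩, hp, ⟨⟨hlk, hlr⟩, hkr, hr⟩, hd⟩ := h
  have hlp : l ∉ p := fun h => hd l h l (Or.inl rfl) rfl
  have hkp : k ∉ p := fun h => hd k h k (Or.inr (Or.inl rfl)) rfl
  have c1 := (passR_commute (n := n) η a (a k) (a l) hik hil hkp hlp).eq
  have c2 := (passR_commute (n := n) η a (a k) (a l) hik hil hkr hlr).eq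
  have y := normR_yangBaxter (n := n) η (a i) (a k) (a l) hη hik hil (Ne.symm hlk)
  rw [passR_append, passR_append, passR_cons, passR_cons, passR_cons, passR_cons, mul_assoc, c1,
    ← mul_assoc, ← mul_assoc]
  congr 1
  simp only [mul_assoc] at y ⊢
  rw [y, ← mul_assoc, c2, mul_assoc]

/-- Two lines that cross each other may do so before or after crossing all sites of a list. -/
theorem passR_mul_passR (η : ℂ) (hη : η ≠ 0) (a : Fin N → ℂ) {k l : Fin N} {r : List (Fin N)}
    (h : (l :: k :: r).Nodup) :
    (passR η a l r * passR η a k r * normR η (a k) (a l) k l : Op n N)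
      = normR η (a k) (a l) k l * passR η a k r * passR η a l r := by
  induction r with
  | nil => simp
  | cons j r ih =>
    have h' : (l :: k :: r).Nodup := by simp_all
    simp only [List.nodup_cons, List.mem_cons, not_or] at h
    obtain ⟨⟨hlk, hlj, hlr⟩, ⟨hkj, hkr⟩, hjr, hr⟩ := h
    have c1 := (passR_commute (n := n) η a (a l) (a j) (Ne.symm hlk) hkj hlr hjr).eq
    have c2 := (passR_commute (n := n) η a (a k) (a j) hlk hlj hkr hjr).eq
    have y := normR_yangBaxter (n := n) η (a k) (a l) (a j) hη (Ne.symm hlk) hkj hlj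
    calc (passR η a l (j :: r) * passR η a k (j :: r) * normR η (a k) (a l) k l : Op n N)
        = passR η a l r * (normR η (a l) (a j) l j * passR η a k r) * normR η (a k) (a j) k j
          * normR η (a k) (a l) k l := by
          simp only [passR_cons, mul_assoc]
      _ = passR η a l r * passR η a k r * (normR η (a l) (a j) l j * normR η (a k) (a j) k j
          * normR η (a k) (a l) k l) := by rw [← c1]; simp only [mul_assoc]
      _ = passR η a l r * passR η a k r * normR η (a k) (a l) k l * normR η (a k) (a j) k j
          * normR η (a l) (a j) l j := by rw [← y]; simp only [mul_assoc]
      _ = normR η (a k) (a l) k l * passR η a k r * (passR η a l r * normR η (a k) (a j) k j)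
          * normR η (a l) (a j) l j := by rw [ih h']; simp only [mul_assoc]
      _ = _ := by rw [c2]; simp only [passR_cons, mul_assoc]

/-- Crossings of the sites of `p ∩ I` with the sites that follow them in `p ++ t`. -/
noncomputable def crossPrefix (η : ℂ) (a : Fin N → ℂ) (I : Finset (Fin N)) (t : List (Fin N)) :
    List (Fin N) → Op n N
  | [] => 1
  | i :: p =>
    if i ∈ I then crossPrefix η a I t p * passR η a i (p ++ t) else crossPrefix η a I t p

theorem crossR_append (η : ℂ) (a : Fin N → ℂ) (I : Finset (Fin N)) (p t : List (Fin N)) :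
    (crossR η a I (p ++ t) : Op n N) = crossR η a I t * crossPrefix η a I t p := by
  induction p with
  | nil => simp [crossPrefix]
  | cons i p ih =>
    rw [List.cons_append, crossR, crossPrefix, ih]
    split_ifs
    · rw [mul_assoc]
    · rfl

theorem crossPrefix_mul_normR (η : ℂ) (hη : η ≠ 0) (a : Fin N → ℂ) (I : Finset (Fin N))
    {k l : Fin N} {p r : List (Fin N)} (h : (p ++ l :: k :: r).Nodup) :
    (crossPrefix η a I (l :: k :: r) p * normR η (a k) (a l) k l : Op n N)
      = normR η (a k) (a l) k l * crossPrefix η a I (k :: l :: r) p := by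
  induction p with
  | nil => simp [crossPrefix]
  | cons i p ih =>
    have h' : (p ++ l :: k :: r).Nodup := (List.nodup_cons.1 h).2
    rw [crossPrefix, crossPrefix]
    split_ifs
    · rw [mul_assoc, passR_mul_normR η hη a h, ← mul_assoc, ih h', mul_assoc]
    · exact ih h'

/-- The exchange relation: multiplication by the R-matrix of two neighbouring sites interchanges
them in the ordering that defines `shiftCov`. -/
theorem shiftCov_vecMul_normR {η : ℂ} (hη : η ≠ 0) (ζ : Fin n → ℂ) (a : Fin N → ℂ)
    (I : Finset (Fin N)) {k l : Fin N} {p r : List (Fin N)} (h : (p ++ l :: k :: r).Nodup)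
    (hkl : η * a k - η⁻¹ * a l ≠ 0) (hlk : η * a l - η⁻¹ * a k ≠ 0) :
    shiftCov η ζ a I (p ++ l :: k :: r) ᵥ* normR η (a k) (a l) k l
      = shiftCov η ζ a I (p ++ k :: l :: r) := by
  have hpre := crossPrefix_mul_normR (n := n) η hη a I h
  have h0 := h
  simp only [List.nodup_append, List.nodup_cons, List.mem_cons, not_or] at h
  obtain ⟨hp, ⟨⟨hlk', hlr⟩, hkr, hr⟩, hd⟩ := h
  have hlp : l ∉ p := fun h => hd l h l (Or.inl rfl) rfl
  have hkp : k ∉ p := fun h => hd k h k (Or.inr (Or.inl rfl)) rfl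
  have c := (crossR_commute (n := n) η a I (a k) (a l) hkr hlr).eq
  rw [shiftCov, shiftCov, crossR_append, crossR_append, Matrix.vecMul_vecMul, mul_assoc, hpre,
    ← mul_assoc, ← Matrix.vecMul_vecMul, ← Matrix.vecMul_vecMul _ _ (crossPrefix _ _ _ _ _)]
  congr 1
  by_cases hk : k ∈ I <;> by_cases hl : l ∈ I
  · have hf : frontList I (p ++ l :: k :: r) = (r.filter (· ∈ I)).reverse ++
        k :: l :: ((p.filter (· ∈ I)).reverse ++ (p ++ r).filter (· ∉ I)) := by
      simp [frontList, hk, hl]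
    have hf' : frontList I (p ++ k :: l :: r) = (r.filter (· ∈ I)).reverse ++
        l :: k :: ((p.filter (· ∈ I)).reverse ++ (p ++ r).filter (· ∉ I)) := by
      simp [frontList, hk, hl]
    have hs := startCov_vecMul_normR hη hkl ζ (i := k) (j := l)
      (p := (r.filter (· ∈ I)).reverse)
      (r := (p.filter (· ∈ I)).reverse ++ (p ++ r).filter (· ∉ I)) (I := I)
      (by simp [hkr]) (by simp [hlr]) (by simp [hkr, hkp]) (by simp [hlr, hlp]) (by simp [hk, hl])
    rw [hf, hf', ← hs, Matrix.vecMul_vecMul]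
    congr 1
    simp only [crossR, hk, hl, if_true, passR_cons]
    have t := passR_mul_passR (n := n) η hη a (k := k) (l := l) (r := r) (by simp_all)
    have u := normR_mul_swap (n := n) hη hlk hkl l k
    rw [mul_assoc _ _ (normR _ _ _ k l), mul_assoc (passR η a l r), u, mul_one, ← mul_assoc,
      ← mul_assoc, ← c, mul_assoc, mul_assoc, ← mul_assoc (normR _ _ _ k l), ← t]
    simp only [mul_assoc]
  · have hf : frontList I (p ++ l :: k :: r) = frontList I (p ++ k :: l :: r) := by
      simp [frontList, hk, hl]
    rw [hf]
    congr 1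
    simp only [crossR, hk, hl, if_true, if_false, passR_cons, mul_assoc]
  · have hf : frontList I (p ++ l :: k :: r) = frontList I (p ++ k :: l :: r) := by
      simp [frontList, hk, hl]
    rw [hf]
    congr 1
    simp only [crossR, hk, hl, if_true, if_false, passR_cons, mul_assoc,
      normR_mul_swap (n := n) hη hlk hkl l k, mul_one]
  · have hf : frontList I (p ++ l :: k :: r) = ((p ++ r).filter (· ∈ I)).reverse ++
        p.filter (· ∉ I) ++ l :: k :: r.filter (· ∉ I) := by
      simp [frontList, hk, hl]
    have hf' : frontList I (p ++ k :: l :: r) = ((p ++ r).filter (· ∈ I)).reverse ++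
        p.filter (· ∉ I) ++ k :: l :: r.filter (· ∉ I) := by
      simp [frontList, hk, hl]
    have hs := startCov_vecMul_normR hη hkl ζ (i := k) (j := l)
      (p := ((p ++ r).filter (· ∈ I)).reverse ++ p.filter (· ∉ I))
      (r := r.filter (· ∉ I)) (I := I)
      (by simp [hkr, hkp]) (by simp [hlr, hlp]) (by simp [hkr]) (by simp [hlr])
      (by simp [hk, hl])
    rw [hf, hf', ← hs, Matrix.vecMul_vecMul]
    congr 1
    simp only [crossR, hk, hl, if_false, c]

/-! ### Elimination of the shift parameter -/

theorem vecMul_Z (ζ : Fin n → ℂ) (i : Fin N) (C : Space n N) (J : Fin N → Fin n) :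
    (C ᵥ* Z ζ i) J = C J * ζ (J i) := by
  rw [Z, Matrix.vecMul_diagonal]

theorem normR_commute_Z (η x y : ℂ) (ζ : Fin n → ℂ) {i k l : Fin N} (hk : i ≠ k) (hl : i ≠ l) :
    Commute (normR η x y k l : Op n N) (Z ζ i) := by
  refine op_ext fun C J => ?_
  have h : Equiv.swap k l i = i := Equiv.swap_apply_of_ne_of_ne hk hl
  simp only [← Matrix.vecMul_vecMul, vecMul_Z, vecMul_normR, Function.comp_apply, h]
  split_ifs <;> ring

theorem passR_commute_Z (η : ℂ) (a : Fin N → ℂ) (ζ : Fin n → ℂ) {i k : Fin N} {r : List (Fin N)}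
    (hk : i ≠ k) (hr : i ∉ r) : Commute (passR η a k r : Op n N) (Z ζ i) := by
  induction r with
  | nil => exact Commute.one_left _
  | cons j r ih =>
    simp only [List.mem_cons, not_or] at hr
    rw [passR_cons]
    exact (ih hr.2).mul_left (normR_commute_Z _ _ _ _ hk hr.1)

theorem crossR_commute_Z (η : ℂ) (a : Fin N → ℂ) (I : Finset (Fin N)) (ζ : Fin n → ℂ) {i : Fin N}
    {w : List (Fin N)} (hi : i ∉ w) : Commute (crossR η a I w : Op n N) (Z ζ i) := by
  induction w with
  | nil => exact Commute.one_left _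
  | cons k w ih =>
    simp only [List.mem_cons, not_or] at hi
    rw [crossR]
    split_ifs
    · exact (ih hi.2).mul_left (passR_commute_Z _ _ _ hi.1 hi.2)
    · exact ih hi.2

theorem startCov_vecMul_Z (η : ℂ) (ζ : Fin n → ℂ) (v : List (Fin N)) {I : Finset (Fin N)}
    {i : Fin N} (hi : i ∉ I) : startCov η ζ v I ᵥ* Z ζ i = startCov η ζ v (insert i I) := by
  funext J
  rw [vecMul_Z, startCov, startCov, Finset.prod_insert hi]
  ring

/-- The R-matrices that pass a site to the left through untwisted sites act on the covector by
moving the site in the ordering; their parameters do not matter. -/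
theorem startCov_vecMul_prod {η : ℂ} (hη : η ≠ 0) (ζ : Fin n → ℂ) (x : ℂ) (y : Fin N → ℂ)
    {i : Fin N} {v p t : List (Fin N)} {I : Finset (Fin N)} (h : (v ++ (p ++ i :: t)).Nodup)
    (hiI : i ∉ I) (hpI : ∀ j ∈ p, j ∉ I) (hxy : ∀ j ∈ p, η * x - η⁻¹ * y j ≠ 0) :
    startCov η ζ (v ++ (p ++ i :: t)) I ᵥ* (p.reverse.map fun j => normR η x (y j) i j).prod
      = startCov η ζ (v ++ i :: (p ++ t)) I := by
  induction p using List.reverseRecOn generalizing t with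
  | nil => simp
  | append_singleton p j ih =>
    have hn : (v ++ (p ++ j :: i :: t)).Nodup := by simpa using h
    have h1 : (v ++ (p ++ i :: j :: t)).Nodup :=
      (List.Perm.nodup_iff (((List.Perm.swap i j t).append_left p).append_left v)).1 hn
    simp only [List.nodup_append, List.nodup_cons, List.mem_cons, not_or, List.mem_append] at hn
    have := startCov_vecMul_normR hη (hxy j (by simp)) ζ (i := i) (j := j) (p := v ++ p)
      (r := t) (I := I) (by grind) (by grind) (by grind) (by grind)
      (by simp [hiI, hpI j (by simp)])
    rw [List.reverse_append, List.reverse_singleton, List.singleton_append, List.map_cons,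
      List.prod_cons, ← Matrix.vecMul_vecMul]
    simp only [List.append_assoc, List.cons_append, List.nil_append] at this ⊢
    rw [this, ih h1 (fun j hj => hpI j (by simp [hj])) (fun j hj => hxy j (by simp [hj]))]

theorem crossR_commute_prod (η : ℂ) (a : Fin N → ℂ) (I : Finset (Fin N)) (x : ℂ) (y : Fin N → ℂ)
    {i : Fin N} {p r : List (Fin N)} (hi : i ∉ r) (hp : ∀ j ∈ p, j ∉ r) :
    Commute (crossR η a I r : Op n N) (p.map fun j => normR η x (y j) i j).prod := by
  induction p with
  | nil => exact Commute.one_right _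
  | cons j p ih =>
    rw [List.map_cons, List.prod_cons]
    exact (crossR_commute η a I x (y j) hi (hp j (by simp))).mul_right
      (ih fun j hj => hp j (by simp [hj]))

theorem orderCov_of_pairwise (η : ℂ) {v : List (Fin N)} (hv : v.Pairwise (· < ·))
    (J : Fin N → Fin n) :
    orderCov η v J = ∏ i ∈ v.toFinset, ∏ k ∈ v.toFinset,
      if i < k then invFactor η J i k else 1 := by
  induction v with
  | nil => simp [orderCov]
  | cons i v ih =>
    rw [List.pairwise_cons] at hv
    have hi : i ∉ v.toFinset := fun h => lt_irrefl _ (hv.1 i (List.mem_toFinset.1 h))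
    have hnd : v.Nodup := hv.2.imp fun h => h.ne
    simp only [orderCov]
    rw [ih hv.2, List.toFinset_cons, Finset.prod_insert hi, Finset.prod_insert hi,
      if_neg (lt_irrefl _), one_mul]
    congr 1
    · rw [← List.prod_toFinset _ hnd]
      exact Finset.prod_congr rfl fun k hk => by rw [if_pos (hv.1 k (List.mem_toFinset.1 hk))]
    · refine Finset.prod_congr rfl fun k hk => ?_
      rw [Finset.prod_insert hi, if_neg (hv.1 k (List.mem_toFinset.1 hk)).not_gt, one_mul]

theorem Evec_eq_orderCov (η : ℂ) : Evec n N η = orderCov η (List.finRange N) := by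
  funext J
  rw [orderCov_of_pairwise η (List.pairwise_lt_finRange N), List.toFinset_finRange,
    ← Finset.prod_product', Finset.univ_product_univ, Evec, len, ← Finset.prod_const,
    Finset.prod_filter]
  refine Finset.prod_congr rfl fun p _ => ?_
  rw [invFactor]
  split_ifs <;> simp_all

theorem filter_finRange_lt {i : Fin N} {p r : List (Fin N)} (h : List.finRange N = p ++ i :: r) :
    (List.finRange N).filter (fun j => j < i) = p := by
  have hs := List.pairwise_lt_finRange N
  rw [h] at hs ⊢
  simp only [List.pairwise_append, List.pairwise_cons, List.mem_cons] at hs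
  rw [List.filter_append, List.filter_eq_self.2, List.filter_eq_nil_iff.2, List.append_nil]
  · intro j hj
    rcases List.mem_cons.1 hj with rfl | hj
    · simp
    · simpa using (hs.2.1.1 j hj).le
  · intro j hj
    simpa using hs.2.2 j hj i (Or.inl rfl)

theorem filter_finRange_gt {i : Fin N} {p r : List (Fin N)} (h : List.finRange N = p ++ i :: r) :
    (List.finRange N).filter (fun j => i < j) = r := by
  have hs := List.pairwise_lt_finRange N
  rw [h] at hs ⊢
  simp only [List.pairwise_append, List.pairwise_cons, List.mem_cons] at hs
  rw [List.filter_append, List.filter_cons, if_neg (by simp), List.filter_eq_nil_iff.2,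
    List.nil_append, List.filter_eq_self.2]
  · intro j hj
    simpa using hs.2.1.1 j hj
  · intro j hj
    simpa using (hs.2.2 j hj i (Or.inl rfl)).le

theorem qShift_insert (q : ℂ) {i : Fin N} {I : Finset (Fin N)} (hi : i ∉ I) (a : Fin N → ℂ) :
    qShift q (insert i I) a = qShift q {i} (qShift q I a) := by
  funext j
  simp only [qShift, Finset.mem_insert, Finset.mem_singleton]
  grind

theorem qShift_empty (q : ℂ) (a : Fin N → ℂ) : qShift q ∅ a = a := by
  funext j
  simp [qShift]

theorem qShift_mem {q : ℂ} {D : Set (Fin N → ℂ)}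
    (hD : ∀ a ∈ D, ∀ i : Fin N, qShift q {i} a ∈ D) {a : Fin N → ℂ} (ha : a ∈ D)
    (I : Finset (Fin N)) : qShift q I a ∈ D := by
  induction I using Finset.induction_on with
  | empty => rwa [qShift_empty]
  | insert i I hi ih =>
    rw [qShift_insert q hi]
    exact hD _ ih i

theorem regularLocus_sub_ne_zero {η : ℂ} (hη : η ≠ 0) {a : Fin N → ℂ} (ha : a ∈ regularLocus N η)
    {i j : Fin N} (hij : i ≠ j) : η * a i - η⁻¹ * a j ≠ 0 := by
  intro h
  apply (ha.2 i j hij).2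
  have : η * (η * a i - η⁻¹ * a j) = 0 := by rw [h, mul_zero]
  rw [mul_sub, mul_inv_cancel_left₀ hη] at this
  linear_combination this

/-- The sites are processed from the last to the first. Those in `r` have been processed: for each
`i ∈ r ∩ I` the equation for `p_i` has been used, and the factors of `K_i` that contain `q` have
been absorbed by the covector. -/
theorem evec_dotProduct_qShift {η q : ℂ} (hη : η ≠ 0) {ζ : Fin n → ℂ}
    {D : Set (Fin N → ℂ)} (hDreg : D ⊆ regularLocus N η)
    (hD : ∀ a ∈ D, ∀ i : Fin N, qShift q {i} a ∈ D) {Φ : (Fin N → ℂ) → Space n N}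
    (hΦ : ∀ a ∈ D, ∀ i : Fin N, Φ (qShift q {i} a) = K η q ζ a i *ᵥ Φ a)
    {a : Fin N → ℂ} (ha : a ∈ D) (I : Finset (Fin N)) {p r : List (Fin N)}
    (h : List.finRange N = p ++ r) :
    Evec n N η ⬝ᵥ Φ (qShift q I a)
      = (startCov η ζ ((r.filter (· ∈ I)).reverse ++ (p ++ r.filter (· ∉ I)))
          (I.filter (· ∈ r)) ᵥ* crossR η a I r) ⬝ᵥ Φ (qShift q (I.filter (· ∈ p)) a) := by
  induction r generalizing p with
  | nil =>
    have hI : I.filter (· ∈ p) = I := by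
      rw [List.append_nil] at h
      simp [← h]
    rw [hI, Evec_eq_orderCov, h]
    congr 1
    funext J
    simp [crossR, startCov]
  | cons i r ih =>
    have hnd : (p ++ i :: r).Nodup := h ▸ List.nodup_finRange N
    have hnd' := hnd
    simp only [List.nodup_append, List.nodup_cons, List.mem_cons] at hnd'
    obtain ⟨hp, ⟨hir, hr⟩, hd⟩ := hnd'
    have hip : i ∉ p := fun hi => hd i hi i (Or.inl rfl) rfl
    have hpr : ∀ j ∈ p, j ∉ r := fun j hj hj' => hd j hj j (Or.inr hj') rfl
    rw [ih (p := p ++ [i]) (by simp [h])]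
    by_cases hi : i ∈ I
    · have hIp : I.filter (· ∈ p ++ [i]) = insert i (I.filter (· ∈ p)) := by
        ext k; simp only [Finset.mem_filter, Finset.mem_insert, List.mem_append,
          List.mem_singleton]; grind
      have hIr : I.filter (· ∈ i :: r) = insert i (I.filter (· ∈ r)) := by
        ext k; simp only [Finset.mem_filter, Finset.mem_insert, List.mem_cons]; grind
      have hb : qShift q (I.filter (· ∈ p)) a ∈ D := qShift_mem hD ha _
      set b := qShift q (I.filter (· ∈ p)) a with hbdef
      have hbeq : ∀ j, j ∉ p → b j = a j := fun j hj => by simp [hbdef, qShift, hj]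
      have hK : K η q ζ b i = (p.reverse.map fun j => normR η (q * b i) (b j) i j).prod * Z ζ i
          * passR η a i r := by
        rw [K, filter_finRange_lt h, filter_finRange_gt h, passR]
        congr 2
        · congr 1
          refine List.map_congr_left fun j hj => ?_
          have hij : i ≠ j := fun e => hip (e ▸ (List.mem_reverse.1 hj))
          refine R_eq_normR η _ _ i j ((hDreg hb).1 j) ?_
          have := regularLocus_sub_ne_zero hη (hDreg (hD b hb i)) hij
          simpa [qShift, hij.symm] using this
        · refine List.map_congr_left fun j hj => ?_
          have hj' : j ∈ r := List.mem_reverse.1 hj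
          have hij : i ≠ j := fun e => hir (e ▸ hj')
          have hjp : j ∉ p := fun hjp => hpr j hjp hj'
          rw [hbeq i hip, hbeq j hjp]
          exact R_eq_normR η _ _ i j ((hDreg ha).1 j) (regularLocus_sub_ne_zero hη (hDreg ha) hij)
      rw [hIp, qShift_insert q (by simp [hip]), hΦ b hb i, Matrix.dotProduct_mulVec, hK, hIr]
      congr 1
      rw [← Matrix.vecMul_vecMul, ← Matrix.vecMul_vecMul, Matrix.vecMul_vecMul _ (crossR η a I r),
        (crossR_commute_prod η a I _ _ hir fun j hj => hpr j (List.mem_reverse.1 hj)).eq,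
        ← Matrix.vecMul_vecMul]
      have hnd'' : ((r.filter (· ∈ I)).reverse ++ (p ++ i :: r.filter (· ∉ I))).Nodup := by
        refine List.Nodup.append (List.nodup_reverse.2 (hr.filter _)) (List.Nodup.append hp
          (List.nodup_cons.2 ⟨by simp [hir], hr.filter _⟩) ?_) ?_
        · intro j hj hj'
          simp only [List.mem_cons, List.mem_filter] at hj'
          grind
        · intro j hj hj'
          simp only [List.mem_reverse, List.mem_append, List.mem_cons, List.mem_filter,
            decide_eq_true_eq] at hj hj'
          grind
      have hmove := startCov_vecMul_prod hη ζ (q * b i) b (i := i)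
        (v := (r.filter (· ∈ I)).reverse) (p := p) (t := r.filter (· ∉ I))
        (I := I.filter (· ∈ r)) hnd'' (by simp [hir]) (fun j hj => by simp [hpr j hj])
        (fun j hj => by
          have hij : i ≠ j := fun e => hip (e ▸ hj)
          have := regularLocus_sub_ne_zero hη (hDreg (hD b hb i)) hij
          simpa [qShift, hij.symm] using this)
      simp only [List.append_assoc, List.singleton_append] at hmove ⊢
      rw [hmove, Matrix.vecMul_vecMul _ (crossR η a I r), (crossR_commute_Z η a I ζ hir).eq,
        ← Matrix.vecMul_vecMul, startCov_vecMul_Z _ _ _ (by simp [hir]), crossR, if_pos hi,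
        Matrix.vecMul_vecMul]
      simp [hi]
    · have hIp : I.filter (· ∈ p ++ [i]) = I.filter (· ∈ p) := by
        ext k; simp only [Finset.mem_filter, List.mem_append, List.mem_singleton]; grind
      have hIr : I.filter (· ∈ i :: r) = I.filter (· ∈ r) := by
        ext k; simp only [Finset.mem_filter, List.mem_cons]; grind
      rw [hIp, hIr, crossR, if_neg hi]
      simp [hi]

/-- The values of `Υ` at the shifted points are pairings of `Φ` with covectors that do not involve
`q`. -/
theorem upsilon_qShift {η q : ℂ} (hη : η ≠ 0) {ζ : Fin n → ℂ}
    {D : Set (Fin N → ℂ)} (hDreg : D ⊆ regularLocus N η)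
    (hD : ∀ a ∈ D, ∀ i : Fin N, qShift q {i} a ∈ D) {Φ : (Fin N → ℂ) → Space n N}
    (hΦ : ∀ a ∈ D, ∀ i : Fin N, Φ (qShift q {i} a) = K η q ζ a i *ᵥ Φ a)
    {a : Fin N → ℂ} (ha : a ∈ D) (I : Finset (Fin N)) :
    Upsilon η Φ (qShift q I a) = shiftCov η ζ a I (List.finRange N) ⬝ᵥ Φ a := by
  rw [Upsilon, evec_dotProduct_qShift hη hDreg hD hΦ ha I (p := []) (List.nil_append _).symm]
  simp [shiftCov, frontList, qShift_empty]

/-! ### Removing the last site -/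

theorem vecMul_passR_congr (η : ℂ) (a : Fin N → ℂ) {P : (Fin N → Fin n) → Prop} {i : Fin N}
    {r : List (Fin N)} (hP : ∀ k ∈ r, ∀ J, P J → P (J ∘ Equiv.swap i k))
    {C C' : Space n N} (h : ∀ J, P J → C J = C' J) {J : Fin N → Fin n} (hJ : P J) :
    (C ᵥ* passR η a i r) J = (C' ᵥ* passR η a i r) J := by
  induction r generalizing J with
  | nil => simpa using h J hJ
  | cons k r ih =>
    have ih' := fun J (hJ : P J) => ih (fun k hk => hP k (by simp [hk])) (J := J) hJ
    rw [passR_cons, ← Matrix.vecMul_vecMul, ← Matrix.vecMul_vecMul, vecMul_normR, vecMul_normR,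
      ih' J hJ, ih' _ (hP k (by simp) J hJ)]

/-- Applied to covectors, the crossing operators of `w` only mix multi-indices that differ by a
permutation of the letters at the sites of `w`. -/
theorem vecMul_crossR_congr (η : ℂ) (a : Fin N → ℂ) (I : Finset (Fin N))
    {P : (Fin N → Fin n) → Prop} {w : List (Fin N)}
    (hP : ∀ i ∈ w, ∀ k ∈ w, ∀ J, P J → P (J ∘ Equiv.swap i k))
    {C C' : Space n N} (h : ∀ J, P J → C J = C' J) {J : Fin N → Fin n} (hJ : P J) :
    (C ᵥ* crossR η a I w) J = (C' ᵥ* crossR η a I w) J := by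
  induction w generalizing J with
  | nil => simpa [crossR] using h J hJ
  | cons i w ih =>
    have ih' := fun J (hJ : P J) =>
      ih (fun i hi k hk => hP i (by simp [hi]) k (by simp [hk])) (J := J) hJ
    rw [crossR]
    split_ifs
    · rw [← Matrix.vecMul_vecMul, ← Matrix.vecMul_vecMul]
      exact vecMul_passR_congr η a (fun k hk J hJ => hP i (by simp) k (by simp [hk]) J hJ) ih' hJ
    · exact ih' J hJ

theorem mul_vecMul_passR (η : ℂ) (a : Fin N → ℂ) {g : Space n N} {i : Fin N}
    {r : List (Fin N)} (hg : ∀ k ∈ r, ∀ J, g (J ∘ Equiv.swap i k) = g J) (C : Space n N) :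
    (g * C) ᵥ* passR η a i r = g * (C ᵥ* passR η a i r) := by
  induction r with
  | nil => simp
  | cons k r ih =>
    rw [passR_cons, ← Matrix.vecMul_vecMul, ih fun k hk => hg k (by simp [hk])]
    funext J
    rw [Pi.mul_apply, ← Matrix.vecMul_vecMul, vecMul_normR, vecMul_normR, Pi.mul_apply,
      Pi.mul_apply, hg k (by simp)]
    split_ifs <;> ring

theorem mul_vecMul_crossR (η : ℂ) (a : Fin N → ℂ) (I : Finset (Fin N)) {g : Space n N}
    {w : List (Fin N)} (hg : ∀ i ∈ w, ∀ k ∈ w, ∀ J, g (J ∘ Equiv.swap i k) = g J)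
    (C : Space n N) : (g * C) ᵥ* crossR η a I w = g * (C ᵥ* crossR η a I w) := by
  induction w with
  | nil => simp [crossR]
  | cons i w ih =>
    rw [crossR]
    split_ifs
    · rw [← Matrix.vecMul_vecMul, ← Matrix.vecMul_vecMul,
        ih fun i hi k hk => hg i (by simp [hi]) k (by simp [hk]),
        mul_vecMul_passR η a fun k hk => hg i (by simp) k (by simp [hk])]
    · exact ih fun i hi k hk => hg i (by simp [hi]) k (by simp [hk])

theorem passR_congr (η : ℂ) {a a' : Fin N → ℂ} {i : Fin N} {r : List (Fin N)} (hi : a i = a' i)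
    (h : ∀ j ∈ r, a j = a' j) : (passR η a i r : Op n N) = passR η a' i r := by
  rw [passR, passR]
  congr 1
  refine List.map_congr_left fun j hj => ?_
  rw [hi, h j (List.mem_reverse.1 hj)]

theorem crossR_congr (η : ℂ) {a a' : Fin N → ℂ} {I I' : Finset (Fin N)} {w : List (Fin N)}
    (ha : ∀ j ∈ w, a j = a' j) (hI : ∀ j ∈ w, j ∈ I ↔ j ∈ I') :
    (crossR η a I w : Op n N) = crossR η a' I' w := by
  induction w with
  | nil => rfl
  | cons i w ih =>
    rw [crossR, crossR, ih (fun j hj => ha j (by simp [hj])) (fun j hj => hI j (by simp [hj])),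
      passR_congr η (ha i (by simp)) fun j hj => ha j (by simp [hj])]
    simp only [hI i (by simp)]

theorem crossPrefix_congr (η : ℂ) (a : Fin N → ℂ) {I I' : Finset (Fin N)} {t p : List (Fin N)}
    (hI : ∀ j ∈ p, j ∈ I ↔ j ∈ I') :
    (crossPrefix η a I t p : Op n N) = crossPrefix η a I' t p := by
  induction p with
  | nil => rfl
  | cons i p ih =>
    rw [crossPrefix, crossPrefix, ih fun j hj => hI j (by simp [hj])]
    simp only [hI i (by simp)]

/-- A last site that belongs to `I` crosses no other site: its crossings with the other sites of `I`
are absorbed by the covector. -/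
theorem startCov_vecMul_crossR_append {η : ℂ} (hη : η ≠ 0) (ζ : Fin n → ℂ) (a : Fin N → ℂ)
    {I : Finset (Fin N)} {x : Fin N} (hxI : x ∈ I) {w t : List (Fin N)} (hw : (w ++ [x]).Nodup)
    (ht : ∀ i ∈ w ++ [x], i ∈ I → i ∉ t)
    (ha : ∀ i ∈ w, η * a i - η⁻¹ * a x ≠ 0) :
    startCov η ζ (x :: ((w.filter (· ∈ I)).reverse ++ t)) I ᵥ* crossR η a I (w ++ [x])
      = startCov η ζ ((w.filter (· ∈ I)).reverse ++ x :: t) I ᵥ* crossR η a I w := by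
  induction w generalizing t with
  | nil => simp [crossR, hxI]
  | cons i w ih =>
    have hw' : (w ++ [x]).Nodup := (List.nodup_cons.1 hw).2
    have hiw : i ∉ w ++ [x] := (List.nodup_cons.1 hw).1
    have hxw : x ∉ w := fun h => (List.nodup_append.1 hw').2.2 x h x (by simp) rfl
    simp only [List.mem_append, List.mem_singleton, not_or] at hiw
    rw [List.cons_append, crossR, crossR]
    split_ifs with hi
    · have ih' := ih (t := i :: t) hw' (fun k hk hkI => by
        have := ht k (by simp at hk ⊢; tauto) hkI
        have hne : k ≠ i := by
          rintro rfl
          simp [hiw] at hk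
        simp [this, hne]) (fun k hk => ha k (by simp [hk]))
      have hs := startCov_vecMul_normR hη (ha i (by simp)) ζ (i := i) (j := x)
        (p := (w.filter (· ∈ I)).reverse) (r := t) (I := I) (by simp [hiw]) (by simp [hxw])
        (ht i (by simp) hi) (ht x (by simp) hxI) (by simp [hi, hxI])
      have hf : ((i :: w).filter (· ∈ I)).reverse = (w.filter (· ∈ I)).reverse ++ [i] := by
        simp [hi]
      rw [hf]
      simp only [List.append_assoc, List.singleton_append]
      rw [← Matrix.vecMul_vecMul, ih', passR_append, passR_cons, passR_nil, one_mul,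
        Matrix.vecMul_vecMul, ← mul_assoc,
        (crossR_commute η a I _ _ hiw.1 hxw).eq, mul_assoc, ← Matrix.vecMul_vecMul, hs]
    · have hf : ((i :: w).filter (· ∈ I)).reverse = (w.filter (· ∈ I)).reverse := by
        simp [hi]
      rw [hf]
      exact ih hw' (fun k hk hkI => ht k (by simp at hk ⊢; tauto) hkI)
        (fun k hk => ha k (by simp [hk]))

/-- The twist seen by the remaining sites once a last site with the letter `c`, not greater than
all other letters, has been removed. -/
noncomputable def twistBy (η : ℂ) (c : Fin n) (ζ : Fin n → ℂ) : Fin n → ℂ :=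
  fun b => (if c < b then η else 1) * ζ b

/-- The multi-indices with the letter `c` at `x` and letters at least `c` along `w`. -/
def MinAt (c : Fin n) (x : Fin N) (w : List (Fin N)) (J : Fin N → Fin n) : Prop :=
  J x = c ∧ ∀ k ∈ w, c ≤ J k

theorem MinAt.swap {c : Fin n} {x : Fin N} {w : List (Fin N)} (hx : x ∉ w) {i k : Fin N}
    (hi : i ∈ w) (hk : k ∈ w) {J : Fin N → Fin n} (hJ : MinAt c x w J) :
    MinAt c x w (J ∘ Equiv.swap i k) := by
  have hxi : x ≠ i := fun h => hx (h ▸ hi)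
  have hxk : x ≠ k := fun h => hx (h ▸ hk)
  refine ⟨by simpa [Equiv.swap_apply_of_ne_of_ne hxi hxk] using hJ.1, fun m hm => ?_⟩
  rw [Function.comp_apply, Equiv.swap_apply_def]
  split_ifs
  · exact hJ.2 k hk
  · exact hJ.2 i hi
  · exact hJ.2 m hm

theorem prod_invFactor_mul_prod {η : ℂ} (ζ : Fin n → ℂ) (I : Finset (Fin N)) {c : Fin n}
    {x : Fin N} {J : Fin N → Fin n} (hJ : J x = c) :
    (∏ i ∈ I, invFactor η J i x) * ∏ i ∈ I, ζ (J i) = ∏ i ∈ I, twistBy η c ζ (J i) := by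
  rw [← Finset.prod_mul_distrib]
  exact Finset.prod_congr rfl fun i _ => by rw [invFactor, twistBy, hJ]

theorem filter_toFinset_eq {I : Finset (Fin N)} {w : List (Fin N)} (hI : I ⊆ w.toFinset) :
    (w.filter (· ∈ I)).toFinset = I := by
  ext i
  simp only [List.mem_toFinset, List.mem_filter, decide_eq_true_eq]
  exact ⟨fun h => h.2, fun h => ⟨List.mem_toFinset.1 (hI h), h⟩⟩

/-- The component of `shiftCov` when the last site `x` belongs to `I` and has a minimal letter. It
does not involve the parameter of `x`. -/
theorem shiftCov_insert_last {η : ℂ} (hη : η ≠ 0) (ζ : Fin n → ℂ) (a : Fin N → ℂ)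
    {I : Finset (Fin N)} {x : Fin N} {w : List (Fin N)} (hw : (w ++ [x]).Nodup)
    (hI : I ⊆ w.toFinset) (ha : ∀ i ∈ w, η * a i - η⁻¹ * a x ≠ 0) {J : Fin N → Fin n}
    (hJ : ∀ k ∈ w, J x ≤ J k) :
    shiftCov η ζ a (insert x I) (w ++ [x]) J
      = ζ (J x) * shiftCov η (twistBy η (J x) ζ) a I w J := by
  have hxw : x ∉ w := fun h => (List.nodup_append.1 hw).2.2 x h x (by simp) rfl
  have hwn : w.Nodup := (List.nodup_append.1 hw).1
  have hxI : x ∉ I := fun h => hxw (List.mem_toFinset.1 (hI h))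
  have hmem : ∀ i ∈ w, i ∈ insert x I ↔ i ∈ I := fun i hi => by
    have : i ≠ x := fun h => hxw (h ▸ hi)
    simp [this]
  have hf1 : w.filter (· ∈ insert x I) = w.filter (· ∈ I) :=
    List.filter_congr fun i hi => by simp only [hmem i hi]
  have hf2 : w.filter (· ∉ insert x I) = w.filter (· ∉ I) :=
    List.filter_congr fun i hi => by simp only [hmem i hi]
  have hf : frontList (insert x I) (w ++ [x])
      = x :: ((w.filter (· ∈ insert x I)).reverse ++ w.filter (· ∉ I)) := by
    rw [← hf2]
    simp [frontList]
  rw [shiftCov, hf, startCov_vecMul_crossR_append hη ζ a (by simp) hw _ ha, hf1, shiftCov,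
    crossR_congr η (fun _ _ => rfl) hmem]
  · rw [← smul_eq_mul, ← Pi.smul_apply, ← Matrix.smul_vecMul]
    refine vecMul_crossR_congr η a I (P := MinAt (J x) x w)
      (fun i hi k hk J' hJ' => hJ'.swap hxw hi hk) (fun J' hJ' => ?_) ⟨rfl, hJ⟩
    have h1 : ((w.filter (· ∉ I)).map (invFactor η J' x)).prod = 1 := by
      refine List.prod_eq_one fun y hy => ?_
      obtain ⟨k, hk, rfl⟩ := List.mem_map.1 hy
      rw [invFactor, if_neg]
      rw [hJ'.1]
      exact (hJ'.2 k (List.mem_filter.1 hk).1).not_gt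
    have h2 : ((w.filter (· ∈ I)).map fun i => invFactor η J' i x).prod
        = ∏ i ∈ I, invFactor η J' i x := by
      rw [← List.prod_toFinset _ (hwn.filter _), filter_toFinset_eq hI]
    simp only [Pi.smul_apply, smul_eq_mul, startCov, frontList, orderCov_append, orderCov,
      List.map_cons, List.prod_cons, h1, Finset.prod_insert hxI, hJ'.1, List.map_reverse,
      List.prod_reverse, List.prod_map_mul, h2]
    rw [← prod_invFactor_mul_prod ζ I hJ'.1]
    ring
  · intro i hi hiI hit
    rw [List.mem_filter] at hit
    simp only [Finset.mem_insert] at hiI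
    rcases hiI with rfl | hiI
    · exact hxw hit.1
    · simp [hiI] at hit

/-- The crossings of the sites of `w ∩ I` with each other, with the sites that follow in `w`, and
with one further site, the last ones through given operators. -/
noncomputable def lineCross (η : ℂ) (a : Fin N → ℂ) (I : Finset (Fin N)) (F : Fin N → Op n N) :
    List (Fin N) → Op n N
  | [] => 1
  | i :: w =>
    if i ∈ I then lineCross η a I F w * (F i * passR η a i w) else lineCross η a I F w

theorem crossR_append_singleton (η : ℂ) (a : Fin N → ℂ) {I : Finset (Fin N)} {x : Fin N}
    (hx : x ∉ I) (w : List (Fin N)) :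
    (crossR η a I (w ++ [x]) : Op n N)
      = lineCross η a I (fun i => normR η (a i) (a x) i x) w := by
  induction w with
  | nil => simp [crossR, lineCross, hx]
  | cons i w ih =>
    rw [List.cons_append, crossR, lineCross, ih, passR_append, passR_cons, passR_nil, one_mul]

theorem lineCross_smul (η : ℂ) (a : Fin N → ℂ) (I : Finset (Fin N)) (c : Fin N → ℂ)
    (F : Fin N → Op n N) (w : List (Fin N)) :
    lineCross η a I (fun i => c i • F i) w
      = ((w.filter (· ∈ I)).map c).prod • lineCross η a I F w := by
  induction w with
  | nil => simp [lineCross]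
  | cons i w ih =>
    rw [lineCross, lineCross, ih]
    split_ifs with hi
    · simp only [List.filter_cons, hi, decide_true, if_true, List.map_cons, List.prod_cons,
        smul_mul_assoc, mul_smul_comm, smul_smul]
    · simp [hi]

/-- `clearedR η 0 1 i x` is the coefficient of the parameter of `x` in the cleared R-matrix. If the
letter at `x` is minimal, it acts diagonally. -/
theorem vecMul_lineCross_top {η : ℂ} (hη : η ≠ 0) (a : Fin N → ℂ) (I : Finset (Fin N))
    {c : Fin n} {x : Fin N} {w v : List (Fin N)} (hw : w.Nodup) (hwv : ∀ i ∈ w, i ∈ v)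
    (hx : x ∉ v) (C : Space n N)
    {J : Fin N → Fin n} (hJ : MinAt c x v J) :
    (C ᵥ* lineCross η a I (fun i => clearedR η 0 1 i x) w) J
      = (((fun J => ((w.filter (· ∈ I)).map fun i => -η⁻¹ * invFactor η J i x).prod) * C)
          ᵥ* crossR η a I w) J := by
  induction w generalizing J with
  | nil => simp [lineCross, crossR]
  | cons i w ih =>
    have hiw : i ∉ w := (List.nodup_cons.1 hw).1
    have ih' := fun J (hJ : MinAt c x v J) =>
      ih (List.nodup_cons.1 hw).2 (fun k hk => hwv k (by simp [hk])) (J := J) hJ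
    have hiv : i ∈ v := hwv i (by simp)
    have hxw : x ∉ w := fun h => hx (hwv x (by simp [h]))
    rw [lineCross, crossR]
    split_ifs with hi
    · rw [← Matrix.vecMul_vecMul, ← Matrix.vecMul_vecMul, ← Matrix.vecMul_vecMul]
      refine vecMul_passR_congr η a (P := MinAt c x v)
        (fun k hk J hJ => hJ.swap hx hiv (hwv k (by simp [hk]))) (fun J hJ => ?_) hJ
      have hg : ∀ k ∈ w, ∀ m ∈ w, ∀ J : Fin N → Fin n,
          (-η⁻¹ * invFactor η (J ∘ Equiv.swap k m) i x) = -η⁻¹ * invFactor η J i x := by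
        intro k hk m hm J
        have hne : ∀ y : Fin N, y ∉ w → Equiv.swap k m y = y := fun y hy =>
          Equiv.swap_apply_of_ne_of_ne (ne_of_mem_of_not_mem hk hy).symm
            (ne_of_mem_of_not_mem hm hy).symm
        rw [invFactor, invFactor, Function.comp_apply, Function.comp_apply, hne i hiw, hne x hxw]
      have hsplit : ((fun J : Fin N → Fin n => (((i :: w).filter (· ∈ I)).map
          fun i => -η⁻¹ * invFactor η J i x).prod) * C)
          = (fun J => -η⁻¹ * invFactor η J i x) * ((fun J => ((w.filter (· ∈ I)).map
            fun i => -η⁻¹ * invFactor η J i x).prod) * C) := by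
        funext J
        simp only [Pi.mul_apply, List.filter_cons, hi, decide_true, if_true, List.map_cons,
          List.prod_cons, mul_assoc]
      rw [hsplit, mul_vecMul_crossR η a I hg, Pi.mul_apply, ← ih' J hJ, vecMul_clearedR]
      have hle : J x ≤ J i := by
        rw [hJ.1]
        exact hJ.2 i hiv
      unfold invFactor
      rcases hle.lt_or_eq with h | h
      · simp only [h, h.ne', if_true, if_false]
        field_simp
        ring
      · simp [h]
    · rw [ih' J hJ]
      simp [hi]

/-- The top coefficient in the parameter of a last site `x ∉ I` with a minimal letter. -/
theorem vecMul_lineCross_top_eq {η : ℂ} (hη : η ≠ 0) (ζ : Fin n → ℂ) (a : Fin N → ℂ)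
    {I : Finset (Fin N)} {x : Fin N} {w : List (Fin N)} (hw : (w ++ [x]).Nodup)
    (hI : I ⊆ w.toFinset) {J : Fin N → Fin n} (hJ : ∀ k ∈ w, J x ≤ J k) :
    (startCov η ζ (frontList I (w ++ [x])) I
        ᵥ* lineCross η a I (fun i => clearedR η 0 1 i x) w) J
      = (-η⁻¹) ^ I.card * (w.map fun k => invFactor η J k x).prod
        * shiftCov η (twistBy η (J x) ζ) a I w J := by
  have hxw : x ∉ w := fun h => (List.nodup_append.1 hw).2.2 x h x (by simp) rfl
  have hwn : w.Nodup := (List.nodup_append.1 hw).1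
  have hxI : x ∉ I := fun h => hxw (List.mem_toFinset.1 (hI h))
  have hf : frontList I (w ++ [x]) = frontList I w ++ [x] := by
    simp [frontList, hxI]
  rw [vecMul_lineCross_top hη a I (c := J x) (v := w) hwn (fun _ h => h) hxw _ ⟨rfl, hJ⟩]
  have hg : ∀ i ∈ w, ∀ k ∈ w, ∀ J : Fin N → Fin n,
      ∏ m ∈ w.toFinset, invFactor η (J ∘ Equiv.swap i k) m x
        = ∏ m ∈ w.toFinset, invFactor η J m x := by
    intro i hi k hk J
    have hxi : x ≠ i := fun h => hxw (h ▸ hi)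
    have hxk : x ≠ k := fun h => hxw (h ▸ hk)
    have hx : Equiv.swap i k x = x := Equiv.swap_apply_of_ne_of_ne hxi hxk
    refine Finset.prod_equiv (Equiv.swap i k) (fun m => ?_) (fun m _ => ?_)
    · rw [Equiv.swap_apply_def]
      split_ifs <;> simp_all
    · simp [invFactor, hx]
  rw [← List.prod_toFinset _ hwn, mul_assoc, ← Pi.mul_apply
    (fun J : Fin N → Fin n => ∏ m ∈ w.toFinset, invFactor η J m x), shiftCov,
    ← mul_vecMul_crossR η a I hg, ← smul_eq_mul ((-η⁻¹) ^ I.card),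
    ← Pi.smul_apply ((-η⁻¹) ^ I.card), ← Matrix.smul_vecMul]
  refine vecMul_crossR_congr η a I (P := MinAt (J x) x w)
    (fun i hi k hk J' hJ' => hJ'.swap hxw hi hk) (fun J' hJ' => ?_) ⟨rfl, hJ⟩
  have h2 : ((w.filter (· ∈ I)).map fun i => -η⁻¹ * invFactor η J' i x).prod
      = (-η⁻¹) ^ I.card * ∏ i ∈ I, invFactor η J' i x := by
    rw [← List.prod_toFinset _ (hwn.filter _), filter_toFinset_eq hI, Finset.prod_mul_distrib,
      Finset.prod_const]
  have h3 : ((frontList I w).map fun i => invFactor η J' i x).prod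
      = ∏ m ∈ w.toFinset, invFactor η J' m x := by
    have hp : (frontList I w).Perm w := by
      refine List.Perm.trans (List.Perm.append_right _ (List.reverse_perm _)) ?_
      simpa using List.filter_append_perm (· ∈ I) w
    rw [(hp.map _).prod_eq, List.prod_toFinset _ hwn]
  simp only [Pi.mul_apply, Pi.smul_apply, smul_eq_mul, h2, hf, startCov, orderCov_append, orderCov,
    List.map_nil, List.prod_nil, List.map_cons, List.prod_cons, mul_one, h3]
  rw [← prod_invFactor_mul_prod ζ I hJ'.1]
  ring

/-- When the parameters of two sites coincide, these sites are interchangeable in `I`. -/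
theorem shiftCov_insert_eq {η : ℂ} (hη : η ≠ 0) (ζ : Fin n → ℂ) (a : Fin N → ℂ)
    {I : Finset (Fin N)} {j x : Fin N} {p r : List (Fin N)} (h : (p ++ j :: (r ++ [x])).Nodup)
    (hj : j ∉ I) (hx : x ∉ I)
    (ha : ∀ i ∈ r, η * a i - η⁻¹ * a j ≠ 0 ∧ η * a j - η⁻¹ * a i ≠ 0)
    (hjx : a x = a j) (hself : η * a j - η⁻¹ * a j ≠ 0) :
    shiftCov η ζ a (insert j I) (p ++ j :: (r ++ [x]))
      = shiftCov η ζ a (insert x I) (p ++ j :: (r ++ [x])) := by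
  induction r generalizing p with
  | nil =>
    have hn := h
    simp only [List.nil_append, List.nodup_append, List.nodup_cons, List.mem_cons,
      List.not_mem_nil, or_false] at hn
    have hjx' : j ≠ x := hn.2.1.1
    have hjp : j ∉ p := fun h => hn.2.2 j h j (Or.inl rfl) rfl
    have hxp : x ∉ p := fun h => hn.2.2 x h x (Or.inr rfl) rfl
    have m1 : ∀ k ∈ p, k ∈ insert j I ↔ k ∈ I := fun k hk => by
      have : k ≠ j := fun e => hjp (e ▸ hk)
      simp [this]
    have m2 : ∀ k ∈ p, k ∈ insert x I ↔ k ∈ I := fun k hk => by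
      have : k ≠ x := fun e => hxp (e ▸ hk)
      simp [this]
    have f1 : frontList (insert j I) (p ++ [j, x])
        = j :: ((p.filter (· ∈ I)).reverse ++ (p.filter (· ∉ I) ++ [x])) := by
      have g1 : p.filter (· ∈ insert j I) = p.filter (· ∈ I) :=
        List.filter_congr fun k hk => by simp only [m1 k hk]
      have g2 : p.filter (· ∉ insert j I) = p.filter (· ∉ I) :=
        List.filter_congr fun k hk => by simp only [m1 k hk]
      simp only [frontList, List.filter_append, g1, g2]
      simp [hjx'.symm, hx]
    have f2 : frontList (insert x I) (p ++ [j, x])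
        = x :: ((p.filter (· ∈ I)).reverse ++ (p.filter (· ∉ I) ++ [j])) := by
      have g1 : p.filter (· ∈ insert x I) = p.filter (· ∈ I) :=
        List.filter_congr fun k hk => by simp only [m2 k hk]
      have g2 : p.filter (· ∉ insert x I) = p.filter (· ∉ I) :=
        List.filter_congr fun k hk => by simp only [m2 k hk]
      simp only [frontList, List.filter_append, g1, g2]
      simp [hjx', hj]
    have c1 : (crossR η a (insert j I) [j, x] : Op n N) = normR η (a j) (a j) j x := by
      simp [crossR, hjx'.symm, hx, passR_cons, hjx]
    have c2 : (crossR η a (insert x I) [j, x] : Op n N) = 1 := by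
      simp [crossR, hjx', hj]
    rw [List.nil_append, shiftCov, shiftCov, crossR_append, crossR_append, c1, c2, one_mul,
      ← Matrix.vecMul_vecMul, crossPrefix_congr η a m1, crossPrefix_congr η a m2, f1, f2]
    congr 1
    funext J
    -- the only crossing of `j` is the one with `x`, which is the permutation of `j` and `x`
    rw [vecMul_normR_self hself, startCov_comp_swap]
    have hI : (insert j I).map (Equiv.swap j x).toEmbedding = insert x I := by
      ext k
      simp only [Finset.mem_map_equiv, Equiv.symm_swap, Finset.mem_insert, Equiv.swap_apply_def]
      grind
    rw [hI]
    congr 1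
    have e1 : ∀ f : Fin N → Bool, (p.filter f).map (Equiv.swap j x) = p.filter f := fun f =>
      map_swap_eq_self (by simp [hjp]) (by simp [hxp])
    simp only [List.map_cons, List.map_append, List.map_reverse, e1, Equiv.swap_apply_left,
      Equiv.swap_apply_right, List.map_nil]
  | cons k r ih =>
    -- move `j` past `k` by an invertible R-matrix
    have hk := ha k (by simp)
    have e1 := shiftCov_vecMul_normR hη ζ a (insert j I) (k := k) (l := j) (p := p)
      (r := r ++ [x]) (by simpa using h) hk.1 hk.2
    have e2 := shiftCov_vecMul_normR hη ζ a (insert x I) (k := k) (l := j) (p := p)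
      (r := r ++ [x]) (by simpa using h) hk.1 hk.2
    have h' : ((p ++ [k]) ++ j :: (r ++ [x])).Nodup := by
      refine (List.Perm.nodup_iff ?_).1 h
      simpa using (List.Perm.swap k j (r ++ [x])).append_left p
    have e3 := ih h' fun i hi => ha i (by simp [hi])
    rw [List.append_assoc, List.singleton_append] at e3
    rw [← e1, ← e2] at e3
    have e4 := congrArg (fun C => C ᵥ* normR η (a j) (a k) j k) e3
    simpa only [Matrix.vecMul_vecMul, normR_mul_swap hη hk.1 hk.2, Matrix.vecMul_one,
      List.cons_append] using e4

/-! ### Polynomial dependence on one parameter -/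

/-- The function `f` is a polynomial of degree at most `d` whose coefficient of degree `d` is
`L`. -/
def HasTop (d : ℕ) (f : ℂ → ℂ) (L : ℂ) : Prop :=
  ∃ p : Polynomial ℂ, p.natDegree ≤ d ∧ p.coeff d = L ∧ ∀ X, f X = p.eval X

theorem HasTop.const (L : ℂ) : HasTop 0 (fun _ => L) L :=
  ⟨Polynomial.C L, by simp, by simp, by simp⟩

theorem HasTop.linear (b L : ℂ) : HasTop 1 (fun X => L * X + b) L := by
  refine ⟨Polynomial.C L * Polynomial.X + Polynomial.C b, Polynomial.natDegree_linear_le, ?_, ?_⟩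
  · simp [Polynomial.coeff_C]
  · simp

theorem HasTop.mul {d d' : ℕ} {f g : ℂ → ℂ} {L L' : ℂ} (hf : HasTop d f L) (hg : HasTop d' g L') :
    HasTop (d + d') (fun X => f X * g X) (L * L') := by
  obtain ⟨p, hp, hpc, hpe⟩ := hf
  obtain ⟨r, hr, hrc, hre⟩ := hg
  refine ⟨p * r, Polynomial.natDegree_mul_le_of_le hp hr, ?_, fun X => by simp [hpe, hre]⟩
  rw [Polynomial.coeff_mul_add_eq_of_natDegree_le hp hr, hpc, hrc]

theorem HasTop.add {d : ℕ} {f g : ℂ → ℂ} {L L' : ℂ} (hf : HasTop d f L) (hg : HasTop d g L') :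
    HasTop d (fun X => f X + g X) (L + L') := by
  obtain ⟨p, hp, hpc, hpe⟩ := hf
  obtain ⟨r, hr, hrc, hre⟩ := hg
  exact ⟨p + r, Polynomial.natDegree_add_le_of_degree_le hp hr, by simp [hpc, hrc],
    fun X => by simp [hpe, hre]⟩

theorem HasTop.sum {ι : Type*} {d : ℕ} (s : Finset ι) {f : ι → ℂ → ℂ} {L : ι → ℂ}
    (h : ∀ i ∈ s, HasTop d (f i) (L i)) :
    HasTop d (fun X => ∑ i ∈ s, f i X) (∑ i ∈ s, L i) := by
  classical
  induction s using Finset.induction_on with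
  | empty => exact ⟨0, by simp, by simp, by simp⟩
  | insert i s hi ih =>
    simp only [Finset.sum_insert hi]
    exact (h i (by simp)).add (ih fun j hj => h j (by simp [hj]))

theorem HasTop.prod {ι : Type*} (s : Finset ι) {f : ι → ℂ → ℂ} {L : ι → ℂ}
    (h : ∀ i ∈ s, HasTop 1 (f i) (L i)) :
    HasTop s.card (fun X => ∏ i ∈ s, f i X) (∏ i ∈ s, L i) := by
  classical
  induction s using Finset.induction_on with
  | empty => simpa using HasTop.const 1
  | insert i s hi ih =>
    simp only [Finset.prod_insert hi, Finset.card_insert_of_notMem hi, add_comm s.card]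
    exact (h i (by simp)).mul (ih fun j hj => h j (by simp [hj]))

/-- A polynomial of degree at most `|s|` that vanishes at `|s|` points is a multiple of the
polynomial with these roots. -/
theorem HasTop.eq_mul_prod {ι : Type*} {s : Finset ι} {f : ℂ → ℂ} {L : ℂ}
    (hf : HasTop s.card f L) {y : ι → ℂ} (hy : Set.InjOn y s) (h0 : ∀ i ∈ s, f (y i) = 0) (X : ℂ) :
    f X = L * ∏ i ∈ s, (X - y i) := by
  obtain ⟨p, hp, hpc, hpe⟩ := hf
  have hdeg : (Lagrange.nodal s y).natDegree = s.card := Lagrange.natDegree_nodal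
  have hz : p - Polynomial.C L * Lagrange.nodal s y = 0 := by
    refine Polynomial.eq_zero_of_degree_lt_of_eval_index_eq_zero s hy ?_ fun i hi => ?_
    · rw [Polynomial.degree_lt_iff_coeff_zero]
      intro m hm
      rw [Polynomial.coeff_sub, Polynomial.coeff_C_mul]
      rcases hm.eq_or_lt with rfl | hm
      · have := (Lagrange.nodal_monic (s := s) (v := y)).coeff_natDegree
        rw [hdeg] at this
        rw [this, hpc, mul_one, sub_self]
      · rw [Polynomial.coeff_eq_zero_of_natDegree_lt (hp.trans_lt hm),
          Polynomial.coeff_eq_zero_of_natDegree_lt (hdeg.trans_lt hm), mul_zero, sub_zero]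
    · rw [Polynomial.eval_sub, ← hpe, h0 i hi, Polynomial.eval_mul, Lagrange.eval_nodal_at_node hi,
        mul_zero, sub_zero]
  rw [hpe, sub_eq_zero.1 hz, Polynomial.eval_mul, Polynomial.eval_C, Lagrange.eval_nodal]

/-- Entrywise version of `HasTop` for operators. -/
def HasTopOp (d : ℕ) (F : ℂ → Op n N) (L : Op n N) : Prop :=
  ∀ J K, HasTop d (fun X => F X J K) (L J K)

theorem HasTopOp.const (L : Op n N) : HasTopOp 0 (fun _ => L) L :=
  fun J K => HasTop.const (L J K)

theorem HasTopOp.mul {d d' : ℕ} {F G : ℂ → Op n N} {L L' : Op n N} (hF : HasTopOp d F L)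
    (hG : HasTopOp d' G L') : HasTopOp (d + d') (fun X => F X * G X) (L * L') := by
  intro J K
  simp only [Matrix.mul_apply]
  exact HasTop.sum _ fun M _ => (hF J M).mul (hG M K)

theorem HasTopOp.vecMul {d : ℕ} {F : ℂ → Op n N} {L : Op n N} (hF : HasTopOp d F L)
    (C : Space n N) (J : Fin N → Fin n) : HasTop d (fun X => (C ᵥ* F X) J) ((C ᵥ* L) J) := by
  simp only [Matrix.vecMul, dotProduct]
  refine HasTop.sum _ fun K _ => ?_
  simpa using (HasTop.const (C K)).mul (hF K J)

theorem hasTopOp_clearedR (η x : ℂ) (i j : Fin N) :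
    HasTopOp 1 (fun X => (clearedR η x X i j : Op n N)) (clearedR η 0 1 i j) := by
  intro K J
  simp only [clearedR, Matrix.of_apply]
  split_ifs
  · convert HasTop.linear (η * x) (-η⁻¹) using 1
    · funext X; ring
    · ring
  · convert HasTop.linear x (-1) using 1
    · funext X; ring
    · ring
  · convert HasTop.linear ((η - η⁻¹) * x) 0 using 1
    · funext X; ring
    · ring
  · convert HasTop.linear 0 (η - η⁻¹) using 1
    · funext X; ring
    · ring
  · convert HasTop.linear 0 0 using 1
    funext X; ring

theorem hasTopOp_lineCross (η : ℂ) (a : Fin N → ℂ) (I : Finset (Fin N)) (x : Fin N)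
    (w : List (Fin N)) :
    HasTopOp (w.filter (· ∈ I)).length
      (fun X => (lineCross η a I (fun i => clearedR η (a i) X i x) w : Op n N))
      (lineCross η a I (fun i => clearedR η 0 1 i x) w) := by
  induction w with
  | nil => exact HasTopOp.const 1
  | cons i w ih =>
    simp only [lineCross]
    split_ifs with hi
    · have hl : ((i :: w).filter (· ∈ I)).length = (w.filter (· ∈ I)).length + (1 + 0) := by
        simp [hi]
      rw [hl]
      exact ih.mul ((hasTopOp_clearedR η (a i) i x).mul (HasTopOp.const _))
    · simpa [hi] using ih

theorem clearedR_eq_smul {η x y : ℂ} (h : η * x - η⁻¹ * y ≠ 0) (i j : Fin N) :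
    (clearedR η x y i j : Op n N) = (η * x - η⁻¹ * y) • normR η x y i j := by
  rw [normR, smul_smul, mul_inv_cancel₀ h, one_smul]

theorem lineCross_congr (η : ℂ) {a a' : Fin N → ℂ} (I : Finset (Fin N)) {F F' : Fin N → Op n N}
    {w : List (Fin N)} (ha : ∀ i ∈ w, a i = a' i) (hF : ∀ i ∈ w, i ∈ I → F i = F' i) :
    lineCross η a I F w = lineCross η a' I F' w := by
  induction w with
  | nil => rfl
  | cons i w ih =>
    rw [lineCross, lineCross, ih (fun j hj => ha j (by simp [hj]))
      (fun j hj => hF j (by simp [hj])),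
      passR_congr η (ha i (by simp)) fun j hj => ha j (by simp [hj])]
    split_ifs with hi
    · rw [hF i (by simp) hi]
    · rfl

theorem lineCross_eq_zero (η : ℂ) (a : Fin N → ℂ) {I : Finset (Fin N)} {F : Fin N → Op n N}
    {w : List (Fin N)} {j : Fin N} (hj : j ∈ w) (hI : j ∈ I) (hF : F j = 0) :
    lineCross η a I F w = 0 := by
  induction w with
  | nil => simp at hj
  | cons i w ih =>
    rw [lineCross]
    rcases List.mem_cons.1 hj with rfl | hj
    · rw [if_pos hI, hF, zero_mul, mul_zero]
    · rw [ih hj, zero_mul, ite_self]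

/-- The covector `shiftCov` for a list with last site `x ∉ I`, as a function of the parameter at
`x`: clearing denominators makes it polynomial. -/
theorem vecMul_lineCross_cleared {η : ℂ} (ζ : Fin n → ℂ) (a : Fin N → ℂ) {I : Finset (Fin N)}
    {x : Fin N} {w : List (Fin N)} (hw : (w ++ [x]).Nodup) (hI : I ⊆ w.toFinset) {X : ℂ}
    (hX : ∀ i ∈ I, η * a i - η⁻¹ * X ≠ 0) :
    startCov η ζ (frontList I (w ++ [x])) I
        ᵥ* lineCross η a I (fun i => clearedR η (a i) X i x) w
      = (∏ i ∈ I, (η * a i - η⁻¹ * X))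
        • shiftCov η ζ (Function.update a x X) I (w ++ [x]) := by
  have hxw : x ∉ w := fun h => (List.nodup_append.1 hw).2.2 x h x (by simp) rfl
  have hwn : w.Nodup := (List.nodup_append.1 hw).1
  have hxI : x ∉ I := fun h => hxw (List.mem_toFinset.1 (hI h))
  have hne : ∀ i ∈ w, i ≠ x := fun i hi => ne_of_mem_of_not_mem hi hxw
  rw [shiftCov, crossR_append_singleton η _ hxI, ← Matrix.vecMul_smul]
  congr 1
  have hprod : ∏ i ∈ I, (η * a i - η⁻¹ * X)
      = ((w.filter (· ∈ I)).map fun i => η * a i - η⁻¹ * X).prod := by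
    rw [← List.prod_toFinset _ (hwn.filter _), filter_toFinset_eq hI]
  rw [hprod, ← lineCross_smul]
  refine lineCross_congr η I (fun i hi => ?_) fun i hi hiI => ?_
  · rw [Function.update_of_ne (hne i hi)]
  · rw [Function.update_self, Function.update_of_ne (hne i hi), clearedR_eq_smul (hX i hiI)]

/-! ### The Hamiltonians on covectors -/

/-- The coefficient `∏_{i ∈ I, j ∈ s ∖ I} (ħ^{1/2} a_i - ħ^{-1/2} a_j) / (a_i - a_j)`. -/
noncomputable def rsCoeff (η : ℂ) (a : Fin N → ℂ) (s I : Finset (Fin N)) : ℂ :=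
  ∏ i ∈ I, ∏ j ∈ s \ I, (η * a i - η⁻¹ * a j) / (a i - a j)

/-- The covector by which `Ĥ_d Υ` is obtained from `Φ`, for the sites of the list `w` in the order
of the list. -/
noncomputable def hamCov (η : ℂ) (ζ : Fin n → ℂ) (a : Fin N → ℂ) (d : ℕ) (w : List (Fin N)) :
    Space n N :=
  ∑ I ∈ w.toFinset.powersetCard d, rsCoeff η a w.toFinset I • shiftCov η ζ a I w

/-- The parameters at the sites of `w` are distinct, and the R-matrices between these sites have no
poles. -/
def RegularOn (η : ℂ) (a : Fin N → ℂ) (w : List (Fin N)) : Prop :=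
  ∀ i ∈ w, ∀ j ∈ w, i ≠ j → a i ≠ a j ∧ η * a i - η⁻¹ * a j ≠ 0

theorem rsCoeff_insert_of_notMem (η : ℂ) (a : Fin N → ℂ) {s I : Finset (Fin N)} {x : Fin N}
    (hx : x ∉ s) (hI : I ⊆ s) :
    rsCoeff η a (insert x s) I
      = rsCoeff η a s I * ((∏ i ∈ I, (η * a i - η⁻¹ * a x)) / ∏ i ∈ I, (a i - a x)) := by
  have hxI : x ∉ I := fun h => hx (hI h)
  rw [rsCoeff, rsCoeff, ← Finset.prod_div_distrib, ← Finset.prod_mul_distrib]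
  refine Finset.prod_congr rfl fun i _ => ?_
  rw [Finset.insert_sdiff_of_notMem _ hxI, Finset.prod_insert (by simp [hx]), mul_comm]

theorem rsCoeff_insert_insert (η : ℂ) (a : Fin N → ℂ) {s I : Finset (Fin N)} {x : Fin N}
    (hx : x ∉ s) (hI : I ⊆ s) :
    rsCoeff η a (insert x s) (insert x I)
      = rsCoeff η a s I
        * ((∏ j ∈ s \ I, (η * a x - η⁻¹ * a j)) / ∏ j ∈ s \ I, (a x - a j)) := by
  have hxI : x ∉ I := fun h => hx (hI h)
  have hs : insert x s \ insert x I = s \ I := by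
    ext k
    simp only [Finset.mem_sdiff, Finset.mem_insert]
    grind
  rw [rsCoeff, rsCoeff, Finset.prod_insert hxI, hs, Finset.prod_div_distrib, mul_comm]

theorem sum_powersetCard_insert {s : Finset (Fin N)} {x : Fin N} (hx : x ∉ s) (d : ℕ)
    (f : Finset (Fin N) → ℂ) :
    ∑ I ∈ (insert x s).powersetCard (d + 1), f I
      = ∑ I ∈ s.powersetCard (d + 1), f I + ∑ I ∈ s.powersetCard d, f (insert x I) := by
  have hmem : ∀ {e : ℕ}, ∀ I ∈ s.powersetCard e, x ∉ I := fun I hI h =>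
    hx ((Finset.mem_powersetCard.1 hI).1 h)
  rw [Finset.powersetCard_succ_insert hx, Finset.sum_union, Finset.sum_image]
  · intro I hI I' hI' h
    rw [← Finset.erase_insert (hmem I hI), ← Finset.erase_insert (hmem I' hI')]
    exact congrArg (fun A => A.erase x) h
  · rw [Finset.disjoint_left]
    intro I hI hI'
    obtain ⟨I', _, rfl⟩ := Finset.mem_image.1 hI'
    exact hmem _ hI (Finset.mem_insert_self x I')

/-- The value of the cleared covector at the point where the parameter of the last site `x` equals
that of a site `j ∈ I`. -/
theorem vecMul_lineCross_coincide {η : ℂ} (hη : η ≠ 0) (ζ : Fin n → ℂ) {a : Fin N → ℂ}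
    {w : List (Fin N)} {x : Fin N} (hw : (w ++ [x]).Nodup) (ha : RegularOn η a w)
    {I : Finset (Fin N)} {j : Fin N} (hj : j ∈ w) (hjI : j ∉ I) (hI : I ⊆ w.toFinset)
    {J : Fin N → Fin n} (hJ : ∀ k ∈ w, J x ≤ J k) :
    (startCov η ζ (frontList (insert j I) (w ++ [x])) (insert j I)
        ᵥ* lineCross η a (insert j I) (fun i => clearedR η (a i) (a j) i x) w) J
      = (η * a j - η⁻¹ * a j) * (∏ i ∈ I, (η * a i - η⁻¹ * a j))
        * (ζ (J x) * shiftCov η (twistBy η (J x) ζ) a I w J) := by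
  have hxw : x ∉ w := fun h => (List.nodup_append.1 hw).2.2 x h x (by simp) rfl
  have hne : ∀ i ∈ w, i ≠ x := fun i hi => ne_of_mem_of_not_mem hi hxw
  have hxI : x ∉ I := fun h => hxw (List.mem_toFinset.1 (hI h))
  -- If `(η - η⁻¹) a_j = 0`, the factor of `j` vanishes and the R-matrix of `j` and `x` need not be
  -- the permutation; otherwise the site `j` may be replaced by `x`.
  by_cases h0 : η * a j - η⁻¹ * a j = 0
  · have hF : (clearedR η (a j) (a j) j x : Op n N) = 0 := by
      ext K J
      have h0' : (η - η⁻¹) * a j = 0 := by rw [sub_mul, h0]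
      simp [clearedR, h0, h0']
    rw [lineCross_eq_zero η a hj (by simp) hF, h0]
    simp
  · have hX : ∀ i ∈ w, η * a i - η⁻¹ * a j ≠ 0 := fun i hi => by
      by_cases hij : i = j
      · rwa [hij]
      · exact (ha i hi j hj hij).2
    set a' := Function.update a x (a j) with ha'
    have haa : ∀ i ∈ w, a' i = a i := fun i hi => Function.update_of_ne (hne i hi) _ _
    have hax : a' x = a j := Function.update_self _ _ _
    have hjI' : insert j I ⊆ w.toFinset :=
      Finset.insert_subset (List.mem_toFinset.2 hj) hI
    rw [vecMul_lineCross_cleared ζ a hw hjI' fun i hi => hX i (List.mem_toFinset.1 (hjI' hi)),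
      Pi.smul_apply, smul_eq_mul, Finset.prod_insert hjI]
    congr 1
    rw [← ha']
    have hlast := shiftCov_insert_last hη ζ a' hw hI
      (fun i hi => by rw [hax, haa i hi]; exact hX i hi) hJ
    have hcr : shiftCov η (twistBy η (J x) ζ) a' I w = shiftCov η (twistBy η (J x) ζ) a I w := by
      rw [shiftCov, shiftCov, crossR_congr η haa fun _ _ => Iff.rfl]
    rw [hcr] at hlast
    rw [← hlast]
    obtain ⟨p, r, rfl⟩ := List.append_of_mem hj
    have hn : (p ++ j :: (r ++ [x])).Nodup := by simpa using hw
    have hr : ∀ i ∈ r, i ≠ j := fun i hi => by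
      have := (List.nodup_cons.1 (List.nodup_append.1 hn).2.1).1
      rintro rfl
      simp [hi] at this
    have haj : a' j = a j := haa j hj
    have := shiftCov_insert_eq hη ζ a' hn hjI hxI (fun i hi => by
      have hiw : i ∈ p ++ j :: r := by simp [hi]
      rw [haa i hiw, haj]
      exact ⟨(ha i hiw j hj (hr i hi)).2, (ha j hj i hiw (hr i hi).symm).2⟩)
      (by rw [hax, haj]) (by rwa [haj])
    rw [List.append_assoc, List.cons_append, this]

/-- The recursion that removes the last site, provided its letter is not greater than the other
letters. As a function of the parameter at this site, the left-hand side times the product of the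
`a_x - a_j` is a polynomial that vanishes at all `a_j`, so the left-hand side is the top
coefficient. -/
theorem hamCov_append_singleton {η : ℂ} (hη : η ≠ 0) (ζ : Fin n → ℂ) {a : Fin N → ℂ} (d : ℕ)
    {w : List (Fin N)} {x : Fin N} (hw : (w ++ [x]).Nodup) (ha : RegularOn η a (w ++ [x]))
    {J : Fin N → Fin n} (hJ : ∀ k ∈ w, J x ≤ J k) :
    hamCov η ζ a (d + 1) (w ++ [x]) J
      = η ^ (w.length - d) * ζ (J x) * hamCov η (twistBy η (J x) ζ) a d w J
        + η⁻¹ ^ (d + 1) * (w.map fun k => invFactor η J k x).prod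
          * hamCov η (twistBy η (J x) ζ) a (d + 1) w J := by
  have hxw : x ∉ w := fun h => (List.nodup_append.1 hw).2.2 x h x (by simp) rfl
  have hwn : w.Nodup := (List.nodup_append.1 hw).1
  have hne : ∀ i ∈ w, i ≠ x := fun i hi => ne_of_mem_of_not_mem hi hxw
  have haw : RegularOn η a w := fun i hi j hj => ha i (by simp [hi]) j (by simp [hj])
  have hxs : x ∉ w.toFinset := fun h => hxw (List.mem_toFinset.1 h)
  have hcard : w.toFinset.card = w.length := List.toFinset_card_of_nodup hwn
  set s := w.toFinset with hs
  set ζ' := twistBy η (J x) ζ with hζ'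
  -- `g I` and `h I` are the terms of the subsets `I ∪ {x}` and `I`, times `∏_j (X - a_j)`, as
  -- functions of the parameter `X` of `x`
  let g : Finset (Fin N) → ℂ → ℂ := fun I X =>
    rsCoeff η a s I * (ζ (J x) * shiftCov η ζ' a I w J) *
      ((∏ j ∈ s \ I, (η * X + -(η⁻¹ * a j))) * ∏ j ∈ I, (1 * X + -a j))
  let h : Finset (Fin N) → ℂ → ℂ := fun I X =>
    rsCoeff η a s I * (-1) ^ (d + 1) *
      ((startCov η ζ (frontList I (w ++ [x])) I
        ᵥ* lineCross η a I (fun i => clearedR η (a i) X i x) w) J *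
        ∏ j ∈ s \ I, (1 * X + -a j))
  let f : ℂ → ℂ := fun X => ∑ I ∈ s.powersetCard d, g I X + ∑ I ∈ s.powersetCard (d + 1), h I X
  have htop : HasTop s.card f
      (η ^ (w.length - d) * ζ (J x) * hamCov η ζ' a d w J
        + η⁻¹ ^ (d + 1) * (w.map fun k => invFactor η J k x).prod
          * hamCov η ζ' a (d + 1) w J) := by
    have hg : HasTop s.card (fun X => ∑ I ∈ s.powersetCard d, g I X)
        (∑ I ∈ s.powersetCard d, η ^ (w.length - d) * ζ (J x) *
          (rsCoeff η a s I * shiftCov η ζ' a I w J)) := by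
      refine HasTop.sum _ fun I hI => ?_
      obtain ⟨hIs, hId⟩ := Finset.mem_powersetCard.1 hI
      have hc : s.card = 0 + ((s \ I).card + I.card) := by
        rw [Finset.card_sdiff_add_card_eq_card hIs, zero_add]
      have h1 := (HasTop.const (rsCoeff η a s I * (ζ (J x) * shiftCov η ζ' a I w J))).mul
        ((HasTop.prod (s \ I) fun j _ => HasTop.linear (-(η⁻¹ * a j)) η).mul
          (HasTop.prod I fun j _ => HasTop.linear (-a j) 1))
      rw [← hc] at h1
      convert h1 using 1
      rw [Finset.prod_const, Finset.prod_const, one_pow, Finset.card_sdiff_of_subset hIs, hcard,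
        hId]
      ring
    have hh : HasTop s.card (fun X => ∑ I ∈ s.powersetCard (d + 1), h I X)
        (∑ I ∈ s.powersetCard (d + 1), η⁻¹ ^ (d + 1) * (w.map fun k => invFactor η J k x).prod *
          (rsCoeff η a s I * shiftCov η ζ' a I w J)) := by
      refine HasTop.sum _ fun I hI => ?_
      obtain ⟨hIs, hId⟩ := Finset.mem_powersetCard.1 hI
      have hl : (w.filter (· ∈ I)).length = I.card := by
        rw [← List.toFinset_card_of_nodup (hwn.filter _), filter_toFinset_eq hIs]
      have hc : s.card = 0 + (I.card + (s \ I).card) := by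
        rw [add_comm I.card, Finset.card_sdiff_add_card_eq_card hIs, zero_add]
      have h0 := (hasTopOp_lineCross (n := n) η a I x w).vecMul
        (startCov η ζ (frontList I (w ++ [x])) I) J
      rw [hl, vecMul_lineCross_top_eq hη ζ a hw hIs hJ, hId] at h0
      rw [hId] at hc
      have h1 := (HasTop.const (rsCoeff η a s I * (-1) ^ (d + 1))).mul
        (h0.mul (HasTop.prod (s \ I) fun j _ => HasTop.linear (-a j) 1))
      rw [← hc] at h1
      convert h1 using 1
      rw [Finset.prod_const, one_pow, neg_pow η⁻¹, ← hζ']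
      have h2 : ((-1 : ℂ) ^ (d + 1)) * (-1) ^ (d + 1) = 1 := by
        rw [← mul_pow]; norm_num
      linear_combination (-(rsCoeff η a s I * η⁻¹ ^ (d + 1)
        * (w.map fun k => invFactor η J k x).prod * shiftCov η ζ' a I w J)) * h2
    have := hg.add hh
    simpa only [hamCov, Finset.sum_apply, Pi.smul_apply, smul_eq_mul, Finset.mul_sum] using this
  have hinj : Set.InjOn a s := fun i hi j hj hij => by
    by_contra hne'
    exact (haw i (List.mem_toFinset.1 hi) j (List.mem_toFinset.1 hj) hne').1 hij
  have hzero : ∀ j ∈ s, f (a j) = 0 := by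
    intro j hj
    have hjw : j ∈ w := List.mem_toFinset.1 hj
    have hjs : j ∉ s.erase j := Finset.notMem_erase j s
    have hins : insert j (s.erase j) = s := Finset.insert_erase hj
    -- the surviving terms are `g I` and `h (I ∪ {j})` with `j ∉ I`, and they cancel in pairs
    have e1 : ∑ I ∈ s.powersetCard d, g I (a j) = ∑ I ∈ (s.erase j).powersetCard d, g I (a j) := by
      refine (Finset.sum_subset (Finset.powersetCard_mono (Finset.erase_subset j s)) ?_).symm
      intro I hI hI'
      obtain ⟨hIs, hId⟩ := Finset.mem_powersetCard.1 hI
      have hjI : j ∈ I := by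
        by_contra hjI
        exact hI' (Finset.mem_powersetCard.2 ⟨Finset.subset_erase.2 ⟨hIs, hjI⟩, hId⟩)
      simp only [g]
      rw [Finset.prod_eq_zero (s := I) hjI (by ring), mul_zero, mul_zero]
    have e2 : ∑ I ∈ s.powersetCard (d + 1), h I (a j)
        = ∑ I ∈ (s.erase j).powersetCard d, h (insert j I) (a j) := by
      conv_lhs => rw [← hins]
      rw [sum_powersetCard_insert hjs, Finset.sum_eq_zero, zero_add]
      intro I hI
      obtain ⟨hIs, hId⟩ := Finset.mem_powersetCard.1 hI
      have hjI : j ∈ s \ I := Finset.mem_sdiff.2 ⟨hj, fun h => hjs (hIs h)⟩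
      simp only [h]
      rw [Finset.prod_eq_zero (s := s \ I) hjI (by ring), mul_zero, mul_zero]
    simp only [f]
    rw [e1, e2, ← Finset.sum_add_distrib]
    refine Finset.sum_eq_zero fun I hI => ?_
    obtain ⟨hIs, hId⟩ := Finset.mem_powersetCard.1 hI
    have hjI : j ∉ I := fun h => hjs (hIs h)
    have hIw : I ⊆ s := hIs.trans (Finset.erase_subset j s)
    have hsd : s \ I = insert j (s.erase j \ I) := by
      conv_lhs => rw [← hins]
      rw [Finset.insert_sdiff_of_notMem _ hjI]
    have hsd' : s \ insert j I = s.erase j \ I := by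
      ext k; simp only [Finset.mem_sdiff, Finset.mem_insert, Finset.mem_erase]; grind
    have hc1 := rsCoeff_insert_of_notMem η a hjs hIs
    have hc2 := rsCoeff_insert_insert η a hjs hIs
    rw [hins] at hc1 hc2
    have n1 : ∏ i ∈ I, (a i - a j) ≠ 0 := Finset.prod_ne_zero_iff.2 fun i hi => by
      have hij : i ≠ j := fun e => hjI (e ▸ hi)
      exact sub_ne_zero.2 (haw i (List.mem_toFinset.1 (hIw hi)) j hjw hij).1
    have n2 : ∏ k ∈ s.erase j \ I, (a j - a k) ≠ 0 := Finset.prod_ne_zero_iff.2 fun k hk => by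
      have hk' := (Finset.mem_sdiff.1 hk).1
      exact sub_ne_zero.2 (haw j hjw k (List.mem_toFinset.1 (Finset.mem_of_mem_erase hk'))
        (Finset.ne_of_mem_erase hk').symm).1
    have s1 : ∏ i ∈ I, (1 * a j + -a i) = (-1) ^ d * ∏ i ∈ I, (a i - a j) := by
      rw [← hId, ← Finset.prod_const, ← Finset.prod_mul_distrib]
      exact Finset.prod_congr rfl fun i _ => by ring
    have s2 : ∏ k ∈ s.erase j \ I, (1 * a j + -a k) = ∏ k ∈ s.erase j \ I, (a j - a k) :=
      Finset.prod_congr rfl fun i _ => by ring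
    have s3 : ∏ k ∈ s.erase j \ I, (η * a j + -(η⁻¹ * a k))
        = ∏ k ∈ s.erase j \ I, (η * a j - η⁻¹ * a k) :=
      Finset.prod_congr rfl fun i _ => by ring
    simp only [g, h]
    rw [vecMul_lineCross_coincide hη ζ hw haw hjw hjI hIw hJ, hsd, hsd',
      Finset.prod_insert (by simp), s1, s2, s3, hc1, hc2]
    field_simp
    ring
  have hval := htop.eq_mul_prod hinj hzero (a x)
  have hP : ∏ i ∈ s, (a x - a i) ≠ 0 := Finset.prod_ne_zero_iff.2 fun i hi => by
    have hi' := List.mem_toFinset.1 hi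
    exact sub_ne_zero.2 (ha x (by simp) i (by simp [hi']) (hne i hi').symm).1
  rw [← mul_left_inj' hP, ← hval]
  have hset : (w ++ [x]).toFinset = insert x s := by
    ext k
    simp [hs]
  simp only [hamCov, Finset.sum_apply, Pi.smul_apply, smul_eq_mul, hset]
  rw [sum_powersetCard_insert hxs, add_comm, add_mul, Finset.sum_mul, Finset.sum_mul]
  simp only [f]
  have hsplit : ∀ I ⊆ s, ∏ i ∈ s, (a x - a i)
      = (∏ i ∈ s \ I, (a x - a i)) * ∏ i ∈ I, (a x - a i) := fun I hI =>
    (Finset.prod_sdiff hI).symm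
  have hnz : ∀ I ⊆ s, ∏ i ∈ I, (a x - a i) ≠ 0 := fun I hI =>
    Finset.prod_ne_zero_iff.2 fun i hi => Finset.prod_ne_zero_iff.1 hP i (hI hi)
  congr 1
  · refine Finset.sum_congr rfl fun I hI => ?_
    obtain ⟨hIs, hId⟩ := Finset.mem_powersetCard.1 hI
    have n1 := hnz _ (Finset.sdiff_subset (s := s) (t := I))
    rw [shiftCov_insert_last hη ζ a hw hIs (fun i hi => (ha i (by simp [hi]) x (by simp)
      (hne i hi)).2) hJ, rsCoeff_insert_insert η a hxs hIs, hsplit I hIs]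
    simp only [g, one_mul, ← sub_eq_add_neg, ← hζ']
    field_simp
  · refine Finset.sum_congr rfl fun I hI => ?_
    obtain ⟨hIs, hId⟩ := Finset.mem_powersetCard.1 hI
    have hX : ∀ i ∈ I, η * a i - η⁻¹ * a x ≠ 0 := fun i hi => by
      have hi' := List.mem_toFinset.1 (hIs hi)
      exact (ha i (by simp [hi']) x (by simp) (hne i hi')).2
    have s1 : ∏ i ∈ I, (a x - a i) = (-1) ^ (d + 1) * ∏ i ∈ I, (a i - a x) := by
      rw [← hId, ← Finset.prod_const, ← Finset.prod_mul_distrib]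
      exact Finset.prod_congr rfl fun i _ => by ring
    have n1 : ∏ i ∈ I, (a i - a x) ≠ 0 := by
      intro h0
      apply hnz I hIs
      rw [s1, h0, mul_zero]
    simp only [h]
    rw [vecMul_lineCross_cleared ζ a hw hIs hX, Function.update_eq_self, Pi.smul_apply,
      smul_eq_mul, rsCoeff_insert_of_notMem η a hxs hIs, hsplit I hIs, s1]
    simp only [one_mul, ← sub_eq_add_neg]
    field_simp

/-! ### The eigenvalues -/

theorem _root_.Multiset.esymm_cons_succ {R : Type*} [CommSemiring R] (b : R) (m : Multiset R)
    (d : ℕ) : (b ::ₘ m).esymm (d + 1) = m.esymm (d + 1) + b * m.esymm d := by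
  simp [Multiset.esymm, Multiset.powersetCard_cons, Multiset.map_map,
    Multiset.sum_map_mul_left]

/-- The definition of `strings` coerces the multiset of the indices `k` to integers; here `k` is a
natural number. -/
theorem strings_eq (η : ℂ) (ζ : Fin n → ℂ) (s : Fin n → ℕ) :
    strings η ζ s = ∑ c : Fin n, (Multiset.range (s c)).map fun k : ℕ =>
      ζ c * η ^ ((s c : ℤ) - 1 - 2 * (k : ℤ)) := by
  simp [strings]

/-- Adding a site with the letter `c` adds one number to the string of `c` and recentres this
string. The recentring is an overall factor `η⁻¹` once the twists of the other letters are multiplied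
by `η`. -/
theorem strings_update {η : ℂ} (hη : η ≠ 0) {ζ ζ' : Fin n → ℂ} {s s' : Fin n → ℕ} {c : Fin n}
    (hc : s' c = s c + 1) (hb : ∀ b ≠ c, s' b = s b) (hζc : ζ' c = ζ c)
    (hζb : ∀ b ≠ c, s b ≠ 0 → ζ' b = η * ζ b) :
    strings η ζ s' = (ζ c * η ^ s c) ::ₘ (strings η ζ' s).map (η⁻¹ • ·) := by
  have hmap : (strings η ζ' s).map (η⁻¹ • ·) = ∑ b : Fin n, (Multiset.range (s b)).map fun k : ℕ =>
      η⁻¹ * (ζ' b * η ^ ((s b : ℤ) - 1 - 2 * (k : ℤ))) := by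
    rw [strings_eq, ← Multiset.coe_mapAddMonoidHom, map_sum]
    simp
  have hrest : ∀ b ≠ c, ((Multiset.range (s' b)).map fun k : ℕ =>
      ζ b * η ^ ((s' b : ℤ) - 1 - 2 * (k : ℤ)))
      = (Multiset.range (s b)).map fun k : ℕ =>
        η⁻¹ * (ζ' b * η ^ ((s b : ℤ) - 1 - 2 * (k : ℤ))) := by
    intro b hbc
    rw [hb b hbc]
    refine Multiset.map_congr rfl fun k hk => ?_
    have : s b ≠ 0 := by
      have := Multiset.mem_range.1 hk
      omega
    rw [hζb b hbc this, mul_assoc, inv_mul_cancel_left₀ hη]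
  have hstr : ((Multiset.range (s' c)).map fun k : ℕ => ζ c * η ^ ((s' c : ℤ) - 1 - 2 * (k : ℤ)))
      = (ζ c * η ^ s c) ::ₘ (Multiset.range (s c)).map fun k : ℕ =>
        η⁻¹ * (ζ' c * η ^ ((s c : ℤ) - 1 - 2 * (k : ℤ))) := by
    rw [hc, ← Multiset.coe_range, ← Multiset.coe_range, List.range_succ_eq_map]
    rw [Multiset.map_coe, List.map_cons, List.map_map, ← Multiset.cons_coe, Multiset.map_coe]
    congr 1
    · congr 1
      rw [← zpow_natCast]
      congr 1
      push_cast
      ring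
    · congr 1
      refine List.map_congr_left fun k _ => ?_
      rw [hζc, Function.comp_apply, show ((s c + 1 : ℕ) : ℤ) - 1 - 2 * ((k.succ : ℕ) : ℤ)
        = -1 + ((s c : ℤ) - 1 - 2 * (k : ℤ)) by push_cast; ring, zpow_add₀ hη, zpow_neg_one]
      ring
  rw [hmap, strings_eq, ← Finset.add_sum_erase _ _ (Finset.mem_univ c), hstr,
    ← Finset.add_sum_erase (Finset.univ : Finset (Fin n)) (fun b => (Multiset.range (s b)).map
      fun k : ℕ => η⁻¹ * (ζ' b * η ^ ((s b : ℤ) - 1 - 2 * (k : ℤ)))) (Finset.mem_univ c),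
    Multiset.cons_add]
  congr 2
  exact Finset.sum_congr rfl fun b hbc => hrest b (Finset.ne_of_mem_erase hbc)

theorem crossR_empty (η : ℂ) (a : Fin N → ℂ) (w : List (Fin N)) :
    (crossR η a ∅ w : Op n N) = 1 := by
  induction w with
  | nil => rfl
  | cons i w ih => simp [crossR, ih]

theorem hamCov_zero (η : ℂ) (ζ : Fin n → ℂ) (a : Fin N → ℂ) (w : List (Fin N))
    (J : Fin N → Fin n) : hamCov η ζ a 0 w J = orderCov η w J := by
  simp [hamCov, rsCoeff, shiftCov, crossR_empty, startCov, frontList]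

theorem prod_invFactor_mul_pow (η : ℂ) {w : List (Fin N)} {x : Fin N} {J : Fin N → Fin n}
    (hJ : ∀ k ∈ w, J x ≤ J k) :
    (w.map fun k => invFactor η J k x).prod * η ^ (w.map J).count (J x) = η ^ w.length := by
  induction w with
  | nil => simp
  | cons i w ih =>
    have ih' := ih fun k hk => hJ k (by simp [hk])
    rw [List.map_cons, List.prod_cons, List.map_cons, List.count_cons, List.length_cons, pow_succ,
      ← ih', pow_add, invFactor]
    rcases (hJ i (by simp)).lt_or_eq with h | h
    · simp [h, h.ne']
      ring
    · simp [h]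
      ring

/-- The eigenvalue equation at weakly decreasing letters. -/
theorem hamCov_of_pairwise {η : ℂ} (hη : η ≠ 0) (ζ : Fin n → ℂ) {a : Fin N → ℂ} (d : ℕ)
    {w : List (Fin N)} (hw : w.Nodup) (ha : RegularOn η a w) {J : Fin N → Fin n}
    (hJ : (w.map J).Pairwise (· ≥ ·)) :
    hamCov η ζ a d w J
      = (strings η ζ fun c => (w.map J).count c).esymm d * orderCov η w J := by
  induction w using List.reverseRecOn generalizing d ζ with
  | nil =>
    cases d with
    | zero => simp [hamCov_zero, Multiset.esymm]
    | succ d =>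
      have h : (∅ : Finset (Fin N)).powersetCard (d + 1) = ∅ :=
        Finset.powersetCard_eq_empty.2 (by simp)
      simp [hamCov, strings_eq, Multiset.esymm, h, Multiset.powersetCard_zero_right]
  | append_singleton w x ih =>
    cases d with
    | zero => simp [hamCov_zero, Multiset.esymm]
    | succ d =>
      have hwn : w.Nodup := (List.nodup_append.1 hw).1
      have haw : RegularOn η a w := fun i hi j hj => ha i (by simp [hi]) j (by simp [hj])
      rw [List.map_append, List.pairwise_append] at hJ
      have hle : ∀ k ∈ w, J x ≤ J k := fun k hk =>
        hJ.2.2 (J k) (List.mem_map_of_mem hk) (J x) (by simp)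
      have ih' := fun d => ih (twistBy η (J x) ζ) d hwn haw hJ.1
      have hstr := strings_update hη (ζ := ζ) (ζ' := twistBy η (J x) ζ)
        (s := fun c => (w.map J).count c) (s' := fun c => ((w ++ [x]).map J).count c) (c := J x)
        (by simp) (fun b hb => by simp [hb.symm]) (by simp [twistBy]) (fun b hb hs => by
          have hb' : b ∈ w.map J := List.count_pos_iff.1 (Nat.pos_of_ne_zero hs)
          obtain ⟨k, hk, rfl⟩ := List.mem_map.1 hb'
          have : J x < J k := lt_of_le_of_ne (hle k hk) hb.symm
          simp [twistBy, this])
      have hord : orderCov η (w ++ [x]) J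
          = orderCov η w J * (w.map fun k => invFactor η J k x).prod := by
        simp [orderCov_append, orderCov]
      have hpow := prod_invFactor_mul_pow η hle
      rw [hamCov_append_singleton hη ζ d hw ha hle, hstr, Multiset.esymm_cons_succ,
        ← Multiset.pow_smul_esymm, ← Multiset.pow_smul_esymm, hord, ih' (d + 1), smul_eq_mul,
        smul_eq_mul]
      -- the subtraction of natural numbers is harmless: there are no subsets if `d > w.length`
      have key : η ^ (w.length - d) * hamCov η (twistBy η (J x) ζ) a d w J
          = η ^ w.length * η⁻¹ ^ d * hamCov η (twistBy η (J x) ζ) a d w J := by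
        by_cases hd : d ≤ w.length
        · rw [pow_sub₀ η hη hd, inv_pow]
        · have hz : hamCov η (twistBy η (J x) ζ) a d w J = 0 := by
            rw [hamCov, Finset.powersetCard_eq_empty.2]
            · simp
            · rw [List.toFinset_card_of_nodup hwn]
              omega
          rw [hz, mul_zero, mul_zero]
      rw [ih' d] at key
      rw [ih' d, mul_right_comm, key, ← hpow]
      ring

/-! ### All letters -/

theorem hamCov_vecMul_normR {η : ℂ} (hη : η ≠ 0) (ζ : Fin n → ℂ) (a : Fin N → ℂ) (d : ℕ)
    {k l : Fin N} {p r : List (Fin N)} (h : (p ++ l :: k :: r).Nodup)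
    (hkl : η * a k - η⁻¹ * a l ≠ 0) (hlk : η * a l - η⁻¹ * a k ≠ 0) :
    hamCov η ζ a d (p ++ l :: k :: r) ᵥ* normR η (a k) (a l) k l
      = hamCov η ζ a d (p ++ k :: l :: r) := by
  have hs : (p ++ l :: k :: r).toFinset = (p ++ k :: l :: r).toFinset := by
    ext m; simp; tauto
  rw [hamCov, hamCov, hs, Matrix.sum_vecMul]
  refine Finset.sum_congr rfl fun I _ => ?_
  rw [Matrix.smul_vecMul, shiftCov_vecMul_normR hη ζ a I h hkl hlk]

theorem orderCov_vecMul_normR {η : ℂ} (hη : η ≠ 0) (a : Fin N → ℂ)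
    {k l : Fin N} {p r : List (Fin N)} (h : (p ++ l :: k :: r).Nodup)
    (hkl : η * a k - η⁻¹ * a l ≠ 0) :
    (orderCov η (p ++ l :: k :: r) : Space n N) ᵥ* normR η (a k) (a l) k l
      = orderCov η (p ++ k :: l :: r) := by
  have h0 : ∀ v : List (Fin N), startCov η (fun _ : Fin n => 1) v ∅ = orderCov η v := fun v => by
    funext J; simp [startCov]
  simp only [List.nodup_append, List.nodup_cons, List.mem_cons, not_or] at h
  obtain ⟨hp, ⟨⟨hlk', hlr⟩, hkr, hr⟩, hd⟩ := h
  rw [← h0, ← h0]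
  exact startCov_vecMul_normR hη hkl _ (fun h => hd k h k (Or.inr (Or.inl rfl)) rfl)
    (fun h => hd l h l (Or.inl rfl) rfl) hkr hlr (by simp)

/-- The eigenvalue equation of the covector `hamCov`, at all multi-indices that have the word `l`
along the ordering of the sites. -/
def EigenAt (η : ℂ) (ζ : Fin n → ℂ) (a : Fin N → ℂ) (d : ℕ) (l : List (Fin n)) : Prop :=
  ∀ (w : List (Fin N)) (J : Fin N → Fin n), w.Nodup → RegularOn η a w → w.map J = l →
    hamCov η ζ a d w J = (strings η ζ fun c => l.count c).esymm d * orderCov η w J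

/-- Both sides of the eigenvalue equation satisfy the exchange relation, and the coefficient
`a_k - a_l` in it does not vanish. Hence the equation passes from a word to the one with two
neighbouring letters interchanged. -/
theorem EigenAt.swap {η : ℂ} (hη : η ≠ 0) {ζ : Fin n → ℂ} {a : Fin N → ℂ} {d : ℕ} {b c : Fin n}
    {u v : List (Fin n)} (h : EigenAt η ζ a d (u ++ b :: c :: v)) :
    EigenAt η ζ a d (u ++ c :: b :: v) := by
  intro w J hw ha hJ
  by_cases hbc : b = c
  · subst hbc
    exact h w J hw ha hJ
  obtain ⟨p, w', rfl, hp, hw'⟩ := List.map_eq_append_iff.1 hJ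
  obtain ⟨l, w'', rfl, hl, hw''⟩ := List.map_eq_cons_iff.1 hw'
  obtain ⟨k, r, rfl, hk, hr⟩ := List.map_eq_cons_iff.1 hw''
  have hcount : (fun e => (u ++ c :: b :: v).count e) = fun e => (u ++ b :: c :: v).count e := by
    funext e
    exact ((List.Perm.swap b c v).append_left u).count_eq e
  have hperm : (p ++ l :: k :: r).Perm (p ++ k :: l :: r) :=
    (List.Perm.swap k l r).append_left p
  have hn := hw
  simp only [List.nodup_append, List.nodup_cons, List.mem_cons, not_or] at hn
  obtain ⟨_, ⟨⟨hlk, hlr⟩, hkr, _⟩, hd⟩ := hn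
  have hlp : l ∉ p := fun h => hd l h l (Or.inl rfl) rfl
  have hkp : k ∉ p := fun h => hd k h k (Or.inr (Or.inl rfl)) rfl
  have rkl := ha k (by simp) l (by simp) (Ne.symm hlk)
  have rlk := ha l (by simp) k (by simp) hlk
  have e1 := h (p ++ k :: l :: r) J (hperm.nodup_iff.1 hw)
    (fun i hi j hj => ha i (hperm.mem_iff.2 hi) j (hperm.mem_iff.2 hj)) (by simp [hp, hl, hk, hr])
  have hsw : (p ++ l :: k :: r).map (J ∘ Equiv.swap k l) = u ++ b :: c :: v := by
    rw [← List.map_map, List.map_append, List.map_cons, List.map_cons, map_swap_eq_self hkp hlp,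
      map_swap_eq_self hkr hlr]
    simp [hp, hl, hk, hr]
  have e2 := h (p ++ l :: k :: r) (J ∘ Equiv.swap k l) hw ha hsw
  have x1 := congrFun (hamCov_vecMul_normR hη ζ a d hw rkl.2 rlk.2) J
  have x2 := congrFun (orderCov_vecMul_normR (n := n) hη a hw rkl.2) J
  have hJne : J k ≠ J l := by rw [hl, hk]; exact hbc
  rw [vecMul_normR, if_neg hJne, inv_mul_eq_iff_eq_mul₀ rkl.2] at x1 x2
  rw [e1, e2] at x1
  rw [hcount]
  refine mul_left_cancel₀ (sub_ne_zero.2 rkl.1) ?_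
  linear_combination x1 - (strings η ζ fun e => (u ++ b :: c :: v).count e).esymm d * x2

theorem EigenAt.perm {η : ℂ} (hη : η ≠ 0) {ζ : Fin n → ℂ} {a : Fin N → ℂ} {d : ℕ}
    {l l' : List (Fin n)} (hl : l.Perm l') (u : List (Fin n)) (h : EigenAt η ζ a d (u ++ l)) :
    EigenAt η ζ a d (u ++ l') := by
  induction hl generalizing u with
  | nil => exact h
  | cons b _ ih => simpa using ih (u ++ [b]) (by simpa using h)
  | swap b c v => exact h.swap hη
  | trans _ _ ih ih' => exact ih' u (ih u h)

theorem hamCov_eq {η : ℂ} (hη : η ≠ 0) (ζ : Fin n → ℂ) {a : Fin N → ℂ} (d : ℕ)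
    {w : List (Fin N)} (hw : w.Nodup) (ha : RegularOn η a w) (J : Fin N → Fin n) :
    hamCov η ζ a d w J
      = (strings η ζ fun c => (w.map J).count c).esymm d * orderCov η w J := by
  have hsort : EigenAt η ζ a d ([] ++ (w.map J).insertionSort (· ≥ ·)) := by
    intro v K hv hav hK
    have h := hamCov_of_pairwise hη ζ d hv hav (J := K) (by
      rw [hK]
      exact List.pairwise_insertionSort (· ≥ ·) (w.map J))
    rwa [hK] at h
  exact EigenAt.perm hη (List.perm_insertionSort (· ≥ ·) (w.map J)) [] hsort w J hw ha rfl

theorem count_map_finRange (J : Fin N → Fin n) (c : Fin n) :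
    ((List.finRange N).map J).count c = (Finset.univ.filter fun k => J k = c).card := by
  rw [← Multiset.coe_count, ← Multiset.map_coe, Multiset.count_map]
  simp only [eq_comm (a := c)]
  rfl

theorem tRSHat_eq {η q : ℂ} (hη : η ≠ 0) (d : ℕ) (f : (Fin N → ℂ) → ℂ) (a : Fin N → ℂ) :
    tRSHat η q d f a = ∑ I ∈ (Finset.univ : Finset (Fin N)).powersetCard d,
      rsCoeff η a Finset.univ I * f (qShift q I a) := by
  rw [tRSHat, tRS, Finset.mul_sum]
  refine Finset.sum_congr rfl fun I hI => ?_
  have hId : I.card = d := (Finset.mem_powersetCard.1 hI).2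
  have hdN : d ≤ N := by
    rw [← hId]
    simpa using Finset.card_le_univ I
  have hfac : ∏ i ∈ I, ∏ j ∈ Iᶜ, (η ^ 2 * a i - a j) / (a i - a j)
      = η ^ (d * (N - d)) * rsCoeff η a Finset.univ I := by
    have hc : Iᶜ.card = N - d := by rw [Finset.card_compl, hId, Fintype.card_fin]
    have h1 : ∀ i j, (η ^ 2 * a i - a j) / (a i - a j)
        = η * ((η * a i - η⁻¹ * a j) / (a i - a j)) := fun i j => by
      rw [← mul_div_assoc, mul_sub, mul_inv_cancel_left₀ hη]
      ring
    simp only [h1, Finset.prod_mul_distrib, Finset.prod_const, hc, hId, rsCoeff,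
      ← Finset.compl_eq_univ_sdiff]
    rw [← pow_mul, mul_comm d]
  have hz : η ^ (-((d : ℤ) * ((N : ℤ) - (d : ℤ)))) * η ^ (d * (N - d)) = 1 := by
    rw [← zpow_natCast, ← zpow_add₀ hη]
    push_cast [hdN]
    simp
  rw [hfac, ← mul_assoc, ← mul_assoc, hz, one_mul]

end QKZ

theorem mainTheorem4 (n N : ℕ) (η q : ℂ) (hη : η ≠ 0) (hq : q ≠ 0)
    (ζ : Fin n → ℂ) (s : Fin n → ℕ)
    (D : Set (Fin N → ℂ)) (hDreg : D ⊆ QKZ.regularLocus N η)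
    (hDshift : ∀ a ∈ D, ∀ i : Fin N, QKZ.qShift q {i} a ∈ D)
    (Φ : (Fin N → ℂ) → QKZ.Space n N)
    (hwt : ∀ a ∈ D, Φ a ∈ QKZ.weightSpace N s)
    (hqKZ : ∀ a ∈ D, ∀ i : Fin N,
      Φ (QKZ.qShift q {i} a) = Matrix.mulVec (QKZ.K η q ζ a i) (Φ a)) :
    ∀ d : ℕ, ∀ a ∈ D,
      QKZ.tRSHat η q d (QKZ.Upsilon η Φ) a
        = (QKZ.strings η ζ s).esymm d * QKZ.Upsilon η Φ a := by
  intro d a ha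
  have hreg : QKZ.RegularOn η a (List.finRange N) := fun i _ j _ hij =>
    ⟨((hDreg ha).2 i j hij).1, QKZ.regularLocus_sub_ne_zero hη (hDreg ha) hij⟩
  have hham : QKZ.tRSHat η q d (QKZ.Upsilon η Φ) a
      = QKZ.hamCov η ζ a d (List.finRange N) ⬝ᵥ Φ a := by
    rw [QKZ.tRSHat_eq hη, QKZ.hamCov, sum_dotProduct, List.toFinset_finRange]
    refine Finset.sum_congr rfl fun I _ => ?_
    rw [QKZ.upsilon_qShift hη hDreg hDshift hqKZ ha, smul_dotProduct, smul_eq_mul]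
  rw [hham, QKZ.Upsilon, QKZ.Evec_eq_orderCov, dotProduct, dotProduct, Finset.mul_sum]
  refine Finset.sum_congr rfl fun J _ => ?_
  by_cases hJ : Φ a J = 0
  · rw [hJ, mul_zero, mul_zero, mul_zero]
  · have hs : (fun c => ((List.finRange N).map J).count c) = s := by
      funext c
      rw [QKZ.count_map_finRange, hwt a ha J hJ c]
    rw [QKZ.hamCov_eq hη ζ d (List.nodup_finRange N) hreg J, hs, mul_assoc]
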